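/- Let $\mathcal A$ be a separable W$^*$-algebra, i.e. a unital C$^*$-algebra that is (isometrically) the dual of a separable Banach space $\mathcal A_*$. The ultraweak topology of $\mathcal A$ is its weak-$*$ topology; a map is normal if it is ultraweakly continuous; $x_k\to x$ strongly means $\psi((x_k-x)^*(x_k-x))\to 0$ for every positive normal linear functional $\psi$ on $\mathcal A$. Let $\{\phi_t\}_{t\ge 0}$ be a CP$_0$-semigroup on $\mathcal A$: each $\phi_t:\mathcal A\to\mathcal A$ is a normal contractive completely positive linear map with $\phi_t(\mathbf 1)=\mathbf 1$, $\phi_0=\mathrm{id}$, $\phi_s\circ\phi_t=\phi_{s+t}$, and $t\mapsto\phi_t(a)$ is ultraweakly continuous for each $a\in\mathcal A$. Let $\omega$ be a faithful normal state on $\mathcal A$. For $\vec t\in[0,\infty)^n$ and $\vec a\in\mathcal A^n$, the moment polynomial $\mathfrak S\langle\!\langle\vec t;\vec a\rangle\!\rangle\in\mathcal A$ is defined recursively as follows, where $\vee$ denotes concatenation, $\Pi(\vec a)=a_1\cdots a_n$ (with $\Pi(\emptyset)=\mathbf 1$), and $\gamma=\{t_1,\dots,t_n\}$. (1) If all $t_i=0$,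 then $\mathfrak S\langle\!\langle\vec t;\vec a\rangle\!\rangle=\Pi(\vec a)$. (2) If $\tau=\min\gamma>0$, then $\mathfrak S\langle\!\langle\vec t;\vec a\rangle\!\rangle=\phi_\tau(\mathfrak S\langle\!\langle\vec t-\tau;\vec a\rangle\!\rangle)$. (3) If $0\in\gamma\ne\{0\}$, let $\tau=\min(\gamma\setminus\{0\})$ and decompose $\langle\!\langle\vec t;\vec a\rangle\!\rangle=\langle\!\langle\vec n_0;\vec z_0\rangle\!\rangle\vee\langle\!\langle\vec s_1;\vec w_1\rangle\!\rangle\vee\langle\!\langle\vec n_1;\vec z_1\rangle\!\rangle\vee\cdots\vee\langle\!\langle\vec s_\ell;\vec w_\ell\rangle\!\rangle\vee\langle\!\langle\vec n_\ell;\vec z_\ell\rangle\!\rangle$ into maximal blocks of zero times ($\vec n_i$) and of nonzero times ($\vec s_i$), where only the first and the last block may be empty. For $S\subseteq\{1,\dots,2\ell-1\}$ let $\mathrm{Col}(S)=c_0\vee c_1\vee\cdots\vee c_{2\ell}$, where for $j\in S\cup\{0,2\ell\}$ $$c_j=\langle\!\langle 0;\mathfrak S\langle\!\langle\vec s_{(j+1)/2};\vec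 w_{(j+1)/2}\rangle\!\rangle\rangle\!\rangle\ (j\text{ odd}),\qquad c_j=\langle\!\langle 0;\Pi(\vec z_{j/2})\rangle\!\rangle\ (j\text{ even}),$$ and for the other $j$ $$c_j=\langle\!\langle\vec s_{(j+1)/2};\vec w_{(j+1)/2}\rangle\!\rangle\ (j\text{ odd}),\qquad c_j=\langle\!\langle\tau;\omega(\Pi(\vec z_{j/2}))\mathbf 1\rangle\!\rangle\ (j\text{ even}).$$ Then $$\mathfrak S\langle\!\langle\vec t;\vec a\rangle\!\rangle=\sum_{S\subseteq\{1,\dots,2\ell-1\},\ S\ne\{2,4,\dots,2(\ell-1)\}}(-1)^{\ell+|S|}\,\mathfrak S(\mathrm{Col}(S)).$$ A sequence $\vec t_k$ in $[0,\infty)^n$ converges non-crossingly to $\vec t$ if $\vec t_k\to\vec t$ and, for all $k$ and all $i,j$, $(t_k)_i\le(t_k)_j$ if and only if $t_i\le t_j$. Proposition. Let $n\ge 1$, let $\vec t_k\to\vec t$ converge non-crossingly in $[0,\infty)^n$, and let $\vec a_k$ be a sequence of $n$-tuples of elements of the closed unit ball of $\mathcal A$ that converges strongly (entrywise) to $\vec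 a$. Then $\mathfrak S\langle\!\langle\vec t_k;\vec a_k\rangle\!\rangle\to\mathfrak S\langle\!\langle\vec t;\vec a\rangle\!\rangle$ strongly. -/

import Mathlib

open scoped NNReal Topology ComplexOrder CStarAlgebra
open Filter

namespace MomentPoly

/-! ### Ultraweak and strong topologies of a C⋆-algebra with a predual

A W⋆-algebra is a C⋆-algebra `A` together with a Banach space `X` and an isometric linear
isomorphism `ι` of `A` with the dual of `X`.  It is separable if `X` is separable. -/

section Topologies

variable {A : Type*} [CStarAlgebra A] [PartialOrder A] [StarOrderedRing A]
variable {X : Type*} [NormedAddCommGroup X] [NormedSpace ℂ X]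

/-- The ultraweak topology of `A`: the weak-⋆ topology given by the predual `X`. -/
noncomputable abbrev ultraweak (ι : A ≃ₗᵢ[ℂ] StrongDual ℂ X) : TopologicalSpace A :=
  TopologicalSpace.induced (fun a (x : X) => ι a x) inferInstance

/-- `u` tends to `a` along `l` in the strong (i.e. ultrastrong) topology, the topology given by
the seminorms `x ↦ ψ (x⋆ x) ^ (1/2)` for the positive ultraweakly continuous functionals `ψ`. -/
def StrongTendsto (ι : A ≃ₗᵢ[ℂ] StrongDual ℂ X) {κ : Type*} (u : κ → A) (l : Filter κ)
    (a : A) : Prop :=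
  ∀ ψ : A →ₚ[ℂ] ℂ, Continuous[ultraweak ι, inferInstance] ψ →
    Tendsto (fun k => ψ (star (u k - a) * (u k - a))) l (𝓝 0)

/-- CP₀-semigroups on the W⋆-algebra `A`: semigroups of normal contractive unital completely
positive maps which are point-ultraweakly continuous. -/
structure IsCP0Semigroup (ι : A ≃ₗᵢ[ℂ] StrongDual ℂ X) (φ : ℝ≥0 → A →CP A) : Prop where
  normal : ∀ t, Continuous[ultraweak ι, ultraweak ι] (φ t)
  contractive : ∀ t a, ‖φ t a‖ ≤ ‖a‖
  map_zero : ∀ a, φ 0 a = a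
  map_add : ∀ s t a, φ (s + t) a = φ s (φ t a)
  continuous : ∀ a, Continuous[inferInstance, ultraweak ι] (fun t => φ t a)
  unital : ∀ t, φ t 1 = 1

/-- Faithful normal states on the W⋆-algebra `A`. -/
structure IsFaithfulNormalState (ι : A ≃ₗᵢ[ℂ] StrongDual ℂ X) (ω : A →ₚ[ℂ] ℂ) : Prop where
  map_one : ω 1 = 1
  normal : Continuous[ultraweak ι, inferInstance] ω
  faithful : ∀ a, ω (star a * a) = 0 → a = 0

end Topologies

/-- The sequence `s` converges non-crossingly to `t`: it converges, and the order relations among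
the entries of each `s k` are those among the entries of `t`. -/
def ConvergesNonCrossingly {n : ℕ} (s : ℕ → Fin n → ℝ≥0) (t : Fin n → ℝ≥0) : Prop :=
  Tendsto s atTop (𝓝 t) ∧ ∀ k i j, s k i ≤ s k j ↔ t i ≤ t j

/-! ### Moment polynomials

A pair `⟨⟨t₁, …, tₙ; a₁, …, aₙ⟩⟩` is the list `[(t₁, a₁), …, (tₙ, aₙ)]`, and the concatenation of
pairs is the concatenation of lists. -/

section Moments

variable {A : Type*}

/-- The finite set of nonzero times that occur in a pair. -/
noncomputable def posTimes (l : List (ℝ≥0 × A)) : Finset ℝ≥0 :=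
  (l.map Prod.fst).toFinset.erase 0

/-- The least nonzero time `τ` that occurs in a pair. -/
noncomputable def minTime (l : List (ℝ≥0 × A)) : ℝ≥0 :=
  sInf (posTimes l : Set ℝ≥0)

/-- Subtract `τ` from all times. -/
noncomputable def shift (τ : ℝ≥0) (l : List (ℝ≥0 × A)) : List (ℝ≥0 × A) :=
  l.map fun p => (p.1 - τ, p.2)

/-- The decomposition
`⟨⟨n₀; z₀⟩⟩ ∨ ⟨⟨s₁; w₁⟩⟩ ∨ ⟨⟨n₁; z₁⟩⟩ ∨ ⋯ ∨ ⟨⟨s_ℓ; w_ℓ⟩⟩ ∨ ⟨⟨n_ℓ; z_ℓ⟩⟩` of a pair into maximal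
stretches of zero times (the `nᵢ`) and of nonzero times (the `sᵢ`); only `z₀` and `z_ℓ` may be
empty.  It is recorded as `(z₀, [(⟨⟨s₁; w₁⟩⟩, z₁), …, (⟨⟨s_ℓ; w_ℓ⟩⟩, z_ℓ)])`. -/
noncomputable def decompose :
    List (ℝ≥0 × A) → List A × List (List (ℝ≥0 × A) × List A)
  | [] => ([], [])
  | (t, a) :: l =>
    if t = 0 then (a :: (decompose l).1, (decompose l).2)
    else
      match decompose l with
      | ([], (w, z) :: bs) => ([], ((t, a) :: w, z) :: bs)
      | (z, bs) => ([], ([(t, a)], z) :: bs)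

/-- The number `ℓ` of stretches of nonzero times. -/
noncomputable def numBlocks (l : List (ℝ≥0 × A)) : ℕ := (decompose l).2.length

/-- The vector `zᵢ` of the decomposition, for `0 ≤ i ≤ ℓ`. -/
noncomputable def zeroPart (l : List (ℝ≥0 × A)) : ℕ → List A
  | 0 => (decompose l).1
  | i + 1 => ((decompose l).2.getD i ([], [])).2

/-- The pair `⟨⟨sᵢ; wᵢ⟩⟩` of the decomposition, for `1 ≤ i ≤ ℓ`. -/
noncomputable def nonzeroPart (l : List (ℝ≥0 × A)) (i : ℕ) : List (ℝ≥0 × A) :=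
  ((decompose l).2.getD (i - 1) ([], [])).1

/-- The collapse of a pair determined by `S ⊆ {1, …, 2ℓ-1}`.  The argument `x` stands for the
values `x i = 𝔖⟨⟨sᵢ; wᵢ⟩⟩`.  The letters with index in `S ∪ {0, 2ℓ}` are elements of `A`, with
time `0`; the other ones are pairs with nonzero times.  All of them are concatenated in the order
of their indices (so the consecutive in- and out-subsets of `S` appear alternately). -/
noncomputable def collapse [Ring A] [Algebra ℂ A] (ω : A → ℂ) (x : ℕ → A)
    (l : List (ℝ≥0 × A)) (S : Finset ℕ) : List (ℝ≥0 × A) :=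
  (List.range (2 * numBlocks l + 1)).flatMap fun j =>
    if j ∈ S ∪ {0, 2 * numBlocks l} then
      if Odd j then [(0, x ((j + 1) / 2))] else [(0, (zeroPart l (j / 2)).prod)]
    else
      if Odd j then nonzeroPart l ((j + 1) / 2)
      else [(minTime l, algebraMap ℂ A (ω (zeroPart l (j / 2)).prod))]

/-- The subsets of `{1, …, 2ℓ-1}` other than `{2, 4, …, 2(ℓ-1)}`. -/
def collapseSets (ℓ : ℕ) : Finset (Finset ℕ) :=
  (Finset.Icc 1 (2 * ℓ - 1)).powerset.erase ((Finset.Icc 1 (ℓ - 1)).image (2 * ·))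

open Classical in
/-- The second component of the termination measure of the moment polynomial. -/
noncomputable def rank (l : List (ℝ≥0 × A)) : ℕ :=
  if ∀ p ∈ l, p.1 ≠ 0 then 0 else numBlocks l + 1

/-! Facts needed for the termination of the recursion. -/

theorem mem_posTimes {l : List (ℝ≥0 × A)} {t : ℝ≥0} :
    t ∈ posTimes l ↔ t ≠ 0 ∧ ∃ p ∈ l, p.1 = t := by
  simp only [posTimes, Finset.mem_erase, List.mem_toFinset, List.mem_map]

theorem minTime_mem {l : List (ℝ≥0 × A)} (h : ∃ p ∈ l, p.1 ≠ 0) :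
    minTime l ∈ posTimes l := by
  obtain ⟨p, hp, h0⟩ := h
  have : (posTimes l).Nonempty := ⟨p.1, mem_posTimes.2 ⟨h0, p, hp, rfl⟩⟩
  rw [minTime, this.csInf_eq_min']
  exact Finset.min'_mem _ _

theorem card_posTimes_shift_lt {l : List (ℝ≥0 × A)} (h : ∃ p ∈ l, p.1 ≠ 0) :
    (posTimes (shift (minTime l) l)).card < (posTimes l).card := by
  have hm := minTime_mem h
  have hsub : posTimes (shift (minTime l) l) ⊆
      ((posTimes l).erase (minTime l)).image (· - minTime l) := by
    intro t ht
    obtain ⟨h0, p, hp, rfl⟩ := mem_posTimes.1 ht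
    obtain ⟨q, hq, rfl⟩ := List.mem_map.1 hp
    simp only [ne_eq, tsub_eq_zero_iff_le, not_le] at h0
    refine Finset.mem_image.2 ⟨q.1, Finset.mem_erase.2 ⟨h0.ne', mem_posTimes.2
      ⟨(lt_of_le_of_lt bot_le h0).ne', q, hq, rfl⟩⟩, rfl⟩
  calc _ ≤ _ := Finset.card_le_card hsub
    _ ≤ _ := Finset.card_image_le
    _ < _ := Finset.card_erase_lt_of_mem hm

theorem posTimes_mono {l l' : List (ℝ≥0 × A)} (h : ∀ p ∈ l, p.1 = 0 ∨ p.1 ∈ posTimes l') :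
    posTimes l ⊆ posTimes l' := by
  intro t ht
  obtain ⟨h0, p, hp, rfl⟩ := mem_posTimes.1 ht
  exact (h p hp).resolve_left h0

theorem decompose_cons_of_ne {t : ℝ≥0} (ht : t ≠ 0) (a : A) (l : List (ℝ≥0 × A)) :
    (∃ w z bs, decompose l = ([], (w, z) :: bs) ∧
      decompose ((t, a) :: l) = ([], ((t, a) :: w, z) :: bs)) ∨
    (¬((decompose l).1 = [] ∧ (decompose l).2 ≠ []) ∧
      decompose ((t, a) :: l) = ([], ([(t, a)], (decompose l).1) :: (decompose l).2)) := by
  rw [decompose, if_neg ht]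
  rcases decompose l with ⟨_ | ⟨z, zs⟩, _ | ⟨⟨w, z'⟩, bs⟩⟩ <;> simp

theorem decompose_blocks (l : List (ℝ≥0 × A)) :
    ∀ b ∈ (decompose l).2, ∀ p ∈ b.1, p ∈ l ∧ p.1 ≠ 0 := by
  induction l with
  | nil => simp [decompose]
  | cons q l ih =>
    obtain ⟨t, a⟩ := q
    by_cases ht : t = 0
    · rw [decompose, if_pos ht]
      exact fun b hb p hp => ⟨List.mem_cons_of_mem _ (ih b hb p hp).1, (ih b hb p hp).2⟩
    · rcases decompose_cons_of_ne ht a l with ⟨w, z, bs, h1, h2⟩ | ⟨_, h2⟩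
      · rw [h1] at ih
        rw [h2]
        intro b hb p hp
        rcases List.mem_cons.1 hb with rfl | hb
        · rcases List.mem_cons.1 hp with rfl | hp
          · exact ⟨List.mem_cons_self, ht⟩
          · have := ih (w, z) List.mem_cons_self p hp
            exact ⟨List.mem_cons_of_mem _ this.1, this.2⟩
        · have := ih b (List.mem_cons_of_mem _ hb) p hp
          exact ⟨List.mem_cons_of_mem _ this.1, this.2⟩
      · rw [h2]
        intro b hb p hp
        rcases List.mem_cons.1 hb with rfl | hb
        · rcases List.mem_singleton.1 hp with rfl
          exact ⟨List.mem_cons_self, ht⟩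
        · have := ih b hb p hp
          exact ⟨List.mem_cons_of_mem _ this.1, this.2⟩

theorem mem_nonzeroPart {l : List (ℝ≥0 × A)} {i : ℕ} {p : ℝ≥0 × A}
    (hp : p ∈ nonzeroPart l i) : p ∈ l ∧ p.1 ≠ 0 := by
  rw [nonzeroPart, List.getD_eq_getElem?_getD] at hp
  rcases h : (decompose l).2[i - 1]? with _ | b
  · simp [h] at hp
  · rw [h] at hp
    exact decompose_blocks l b (List.mem_of_getElem? h) p hp

theorem numBlocks_zeros_append {u : List (ℝ≥0 × A)} (hu : ∀ p ∈ u, p.1 = 0)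
    (v : List (ℝ≥0 × A)) : numBlocks (u ++ v) = numBlocks v := by
  induction u with
  | nil => rfl
  | cons q u ih =>
    obtain ⟨t, a⟩ := q
    have ht : t = 0 := hu _ List.mem_cons_self
    rw [List.cons_append, numBlocks, decompose, if_pos ht]
    exact ih fun p hp => hu p (List.mem_cons_of_mem _ hp)

/-- The pair is nonempty and its first time is nonzero. -/
def StartsNonzero (l : List (ℝ≥0 × A)) : Prop :=
  (decompose l).1 = [] ∧ (decompose l).2 ≠ []

theorem numBlocks_nonzeros_append {u : List (ℝ≥0 × A)} (hu : ∀ p ∈ u, p.1 ≠ 0)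
    (v : List (ℝ≥0 × A)) :
    (StartsNonzero v → StartsNonzero (u ++ v) ∧ numBlocks (u ++ v) = numBlocks v) ∧
    (¬StartsNonzero v → numBlocks (u ++ v) = numBlocks v ∨
      StartsNonzero (u ++ v) ∧ numBlocks (u ++ v) = numBlocks v + 1) := by
  induction u with
  | nil => simp
  | cons q u ih =>
    obtain ⟨t, a⟩ := q
    have ht : t ≠ 0 := hu _ List.mem_cons_self
    have ih := ih fun p hp => hu p (List.mem_cons_of_mem _ hp)
    rcases decompose_cons_of_ne ht a (u ++ v) with ⟨w, z, bs, h1, h2⟩ | ⟨h1, h2⟩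
    · have e1 : numBlocks ((t, a) :: u ++ v) = numBlocks (u ++ v) := by
        simp [numBlocks, h1, h2]
      have e2 : StartsNonzero ((t, a) :: u ++ v) := by
        simp [StartsNonzero, h2]
      rw [e1]
      exact ⟨fun h => ⟨e2, (ih.1 h).2⟩, fun h => (ih.2 h).imp id fun h => ⟨e2, h.2⟩⟩
    · have e1 : numBlocks ((t, a) :: u ++ v) = numBlocks (u ++ v) + 1 := by
        simp [numBlocks, h2]
      have e2 : StartsNonzero ((t, a) :: u ++ v) := by
        simp [StartsNonzero, h2]
      refine ⟨fun h => absurd (ih.1 h).1 h1, fun h => ?_⟩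
      rcases ih.2 h with h' | h'
      · exact Or.inr ⟨e2, by rw [e1, h']⟩
      · exact absurd h'.1 h1

theorem numBlocks_letters {ℓ : ℕ} (S : Finset ℕ) (L : ℕ → List (ℝ≥0 × A))
    (hz : ∀ j, j ∈ S ∪ {0, 2 * ℓ} → ∀ p ∈ L j, p.1 = 0)
    (hn : ∀ j, j ∉ S ∪ {0, 2 * ℓ} → ∀ p ∈ L j, p.1 ≠ 0) (m : ℕ) (hm : m ≤ ℓ) :
    numBlocks ((List.range' (2 * (ℓ - m) + 1) (2 * m)).flatMap L) ≤ m ∧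
    (numBlocks ((List.range' (2 * (ℓ - m) + 1) (2 * m)).flatMap L) = m →
      (1 ≤ m → StartsNonzero ((List.range' (2 * (ℓ - m) + 1) (2 * m)).flatMap L)) ∧
      ∀ j, 2 * (ℓ - m) < j → j < 2 * ℓ → (j ∈ S ↔ Even j)) := by
  induction m with
  | zero =>
    refine ⟨by simp [numBlocks, decompose], fun _ => ⟨by omega, fun j h1 h2 => by omega⟩⟩
  | succ m ih =>
    obtain ⟨ih1, ih2⟩ := ih (by omega)
    have hr : List.range' (2 * (ℓ - (m + 1)) + 1) (2 * (m + 1)) =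
        (2 * (ℓ - m) - 1) :: (2 * (ℓ - m)) :: List.range' (2 * (ℓ - m) + 1) (2 * m) := by
      rw [show 2 * (m + 1) = 2 * m + 1 + 1 by ring, List.range'_succ, List.range'_succ,
        show 2 * (ℓ - (m + 1)) + 1 = 2 * (ℓ - m) - 1 by omega,
        show 2 * (ℓ - m) - 1 + 1 = 2 * (ℓ - m) by omega]
    rw [hr, List.flatMap_cons, List.flatMap_cons]
    set P := (List.range' (2 * (ℓ - m) + 1) (2 * m)).flatMap L with hP
    set o := 2 * (ℓ - m) - 1 with ho
    set e := 2 * (ℓ - m) with he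
    have he0 : m = 0 → e ∈ S ∪ {0, 2 * ℓ} := by
      intro h
      simp [he, h]
    have key : numBlocks (L e ++ P) ≤ m ∧ (numBlocks (L e ++ P) = m →
        e ∉ S ∪ {0, 2 * ℓ} → StartsNonzero (L e ++ P)) ∧
        (numBlocks (L e ++ P) = m → e ∈ S ∪ {0, 2 * ℓ} → numBlocks P = m) := by
      by_cases hE : e ∈ S ∪ {0, 2 * ℓ}
      · rw [numBlocks_zeros_append (hz e hE)]
        exact ⟨ih1, fun _ h => absurd hE h, fun h _ => h⟩
      · have hm1 : 1 ≤ m := by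
          by_contra h
          exact hE (he0 (by omega))
        have := numBlocks_nonzeros_append (hn e hE) P
        by_cases hs : StartsNonzero P
        · have h3 := this.1 hs
          exact ⟨h3.2 ▸ ih1, fun _ _ => h3.1, fun _ h => absurd h hE⟩
        · have hlt : numBlocks P < m :=
            lt_of_le_of_ne ih1 fun h => hs ((ih2 h).1 hm1)
          rcases this.2 hs with h | h
          · exact ⟨by omega, fun h' => by omega, fun h' => by omega⟩
          · exact ⟨by omega, fun _ _ => h.1, fun _ h => absurd h hE⟩
    obtain ⟨k1, k2, k3⟩ := key
    by_cases hO : o ∈ S ∪ {0, 2 * ℓ}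
    · rw [numBlocks_zeros_append (hz o hO)]
      exact ⟨by omega, fun h => by omega⟩
    · have := numBlocks_nonzeros_append (hn o hO) (L e ++ P)
      by_cases hs : StartsNonzero (L e ++ P)
      · have h3 := this.1 hs
        exact ⟨by omega, fun h => by omega⟩
      · rcases this.2 hs with h | h
        · exact ⟨by omega, fun h => by omega⟩
        · refine ⟨by omega, fun h4 => ⟨fun _ => h.1, ?_⟩⟩
          have hem : numBlocks (L e ++ P) = m := by omega
          have hE : e ∈ S ∪ {0, 2 * ℓ} := by
            by_contra hE
            exact hs (k2 hem hE)
          have h5 := (ih2 (k3 hem hE)).2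
          intro j hj1 hj2
          rcases lt_trichotomy j e with hj | hj | hj
          · have hjo : j = o := by omega
            have h6 : ¬Even o := by
              rw [Nat.even_iff]
              omega
            have h7 : o ∉ S := fun h => hO (Finset.mem_union_left _ h)
            rw [hjo]
            exact iff_of_false h7 h6
          · have h6 : Even e := by
              rw [Nat.even_iff]
              omega
            have h7 : e ∈ S := by
              rcases Finset.mem_union.1 hE with h | h
              · exact h
              · simp only [Finset.mem_insert, Finset.mem_singleton] at h
                omega
            rw [hj]
            exact iff_of_true h7 h6
          · exact h5 j (by omega) hj2

theorem lex_nonzeroPart {l : List (ℝ≥0 × A)} (h : ¬∀ p ∈ l, p.1 ≠ 0) (i : ℕ) :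
    Prod.Lex (· < ·) (· < ·) ((posTimes (nonzeroPart l i)).card, rank (nonzeroPart l i))
      ((posTimes l).card, rank l) := by
  have h1 : (posTimes (nonzeroPart l i)).card ≤ (posTimes l).card :=
    Finset.card_le_card <| posTimes_mono fun p hp =>
      Or.inr (mem_posTimes.2 ⟨(mem_nonzeroPart hp).2, p, (mem_nonzeroPart hp).1, rfl⟩)
  have h2 : rank (nonzeroPart l i) < rank l := by
    rw [rank, rank, if_pos fun p hp => (mem_nonzeroPart hp).2, if_neg h]
    omega
  rcases h1.lt_or_eq with h3 | h3
  · exact Prod.Lex.left _ _ h3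
  · rw [h3]
    exact Prod.Lex.right _ h2

section Collapse

variable [Ring A] [Algebra ℂ A] (ω : A → ℂ) (x : ℕ → A)

theorem mem_collapse {l : List (ℝ≥0 × A)} (S : Finset ℕ) {p : ℝ≥0 × A}
    (hp : p ∈ collapse ω x l S) : p.1 = 0 ∨ p.1 = minTime l ∨ ∃ q ∈ l, q.1 = p.1 := by
  obtain ⟨j, -, hj⟩ := List.mem_flatMap.1 hp
  split_ifs at hj
  · simp_all
  · simp_all
  · exact Or.inr (Or.inr ⟨p, (mem_nonzeroPart hj).1, rfl⟩)
  · simp_all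

theorem posTimes_collapse {l : List (ℝ≥0 × A)} (h : ∃ p ∈ l, p.1 ≠ 0) (S : Finset ℕ) :
    posTimes (collapse ω x l S) ⊆ posTimes l := by
  refine posTimes_mono fun p hp => ?_
  rcases mem_collapse ω x S hp with h' | h' | ⟨q, hq, h'⟩
  · exact Or.inl h'
  · exact Or.inr (h' ▸ minTime_mem h)
  · by_cases h0 : p.1 = 0
    · exact Or.inl h0
    · exact Or.inr (mem_posTimes.2 ⟨h0, q, hq, h'⟩)

theorem numBlocks_collapse_lt {l : List (ℝ≥0 × A)} (h : ∃ p ∈ l, p.1 ≠ 0) {S : Finset ℕ}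
    (hS : S ∈ collapseSets (numBlocks l)) :
    numBlocks (collapse ω x l S) < numBlocks l := by
  have hτ : minTime l ≠ 0 := (mem_posTimes.1 (minTime_mem h)).1
  rw [collapse]
  set L : ℕ → List (ℝ≥0 × A) := fun j =>
    if j ∈ S ∪ {0, 2 * numBlocks l} then
      if Odd j then [(0, x ((j + 1) / 2))] else [(0, (zeroPart l (j / 2)).prod)]
    else
      if Odd j then nonzeroPart l ((j + 1) / 2)
      else [(minTime l, algebraMap ℂ A (ω (zeroPart l (j / 2)).prod))] with hL
  have hz : ∀ j, j ∈ S ∪ {0, 2 * numBlocks l} → ∀ p ∈ L j, p.1 = 0 := by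
    intro j hj p hp
    simp only [hL, if_pos hj] at hp
    split_ifs at hp <;> simp_all
  have hn : ∀ j, j ∉ S ∪ {0, 2 * numBlocks l} → ∀ p ∈ L j, p.1 ≠ 0 := by
    intro j hj p hp
    simp only [hL, if_neg hj] at hp
    split_ifs at hp
    · exact (mem_nonzeroPart hp).2
    · rw [List.mem_singleton.1 hp]
      exact hτ
  obtain ⟨h1, h2⟩ := numBlocks_letters S L hz hn (numBlocks l) le_rfl
  rw [List.range_eq_range', List.range'_succ, List.flatMap_cons,
    numBlocks_zeros_append (hz 0 (by simp))]
  simp only [Nat.sub_self, Nat.mul_zero, Nat.zero_add] at h1 h2 ⊢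
  refine lt_of_le_of_ne h1 fun h3 => ?_
  have h4 := (h2 h3).2
  obtain ⟨hne, hsub⟩ := Finset.mem_erase.1 hS
  rw [Finset.mem_powerset] at hsub
  refine hne (Finset.ext fun j => ?_)
  simp only [Finset.mem_image, Finset.mem_Icc]
  constructor
  · intro hj
    have hj' := Finset.mem_Icc.1 (hsub hj)
    obtain ⟨r, hr⟩ := (h4 j (by omega) (by omega)).1 hj
    exact ⟨r, by omega, by omega⟩
  · rintro ⟨r, hr, rfl⟩
    exact (h4 _ (by omega) (by omega)).2 (even_two_mul r)

theorem lex_collapse {l : List (ℝ≥0 × A)} (h0 : ¬∀ p ∈ l, p.1 = 0) (h : ¬∀ p ∈ l, p.1 ≠ 0)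
    {S : Finset ℕ} (hS : S ∈ collapseSets (numBlocks l)) :
    Prod.Lex (· < ·) (· < ·)
      ((posTimes (collapse ω x l S)).card, rank (collapse ω x l S))
      ((posTimes l).card, rank l) := by
  push Not at h0
  have h1 := Finset.card_le_card (posTimes_collapse ω x h0 S)
  have h2 : rank (collapse ω x l S) < rank l := by
    have := numBlocks_collapse_lt ω x h0 hS
    rw [rank, rank, if_neg h]
    split_ifs <;> omega
  rcases h1.lt_or_eq with h3 | h3
  · exact Prod.Lex.left _ _ h3
  · rw [h3]
    exact Prod.Lex.right _ h2

end Collapse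

open Classical in
/-- The moment polynomial `𝔖⟨⟨t₁, …, tₙ; a₁, …, aₙ⟩⟩` with respect to the family `φ` of maps and
the functional `ω`, by recursion.  If all times are zero it is the product of the `aᵢ`; if all
times are nonzero, their minimum `τ` is split off; otherwise it is the alternating sum of the
moment polynomials of all collapses of the pair but the trivial one. -/
noncomputable def momentPolynomial [Ring A] [Algebra ℂ A] (φ : ℝ≥0 → A → A) (ω : A → ℂ)
    (l : List (ℝ≥0 × A)) : A :=
  if h0 : ∀ p ∈ l, p.1 = 0 then (l.map Prod.snd).prod
  else if h : ∀ p ∈ l, p.1 ≠ 0 then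
    φ (minTime l) (momentPolynomial φ ω (shift (minTime l) l))
  else
    ∑ S : collapseSets (numBlocks l), (-1 : ℤ) ^ (numBlocks l + S.1.card) •
      momentPolynomial φ ω
        (collapse ω (fun i => momentPolynomial φ ω (nonzeroPart l i)) l S.1)
termination_by ((posTimes l).card, rank l)
decreasing_by
  · exact Prod.Lex.left _ _ (card_posTimes_shift_lt (by push Not at h0; exact h0))
  · exact lex_nonzeroPart h i
  · exact lex_collapse ω _ h0 h S.2

end Moments

end MomentPoly

namespace MomentPoly

/-! ### Weak-⋆ limits and the separate weak-⋆ continuity of multiplication -/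

section WeakStar

variable {A : Type*} [CStarAlgebra A]
variable {X : Type*} [NormedAddCommGroup X] [NormedSpace ℂ X]
variable {κ : Type*}

/-- Weak-⋆ convergence of `u` to `a` along `l`, tested on the elements of the predual. -/
def WTendsto (ι : A ≃ₗᵢ[ℂ] StrongDual ℂ X) (u : κ → A) (l : Filter κ) (a : A) : Prop :=
  ∀ ξ, Tendsto (fun k => ι (u k) ξ) l (𝓝 (ι a ξ))

variable {ι : A ≃ₗᵢ[ℂ] StrongDual ℂ X} {u v : κ → A} {l : Filter κ} {a b : A}

theorem WTendsto.add (hu : WTendsto ι u l a) (hv : WTendsto ι v l b) :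
    WTendsto ι (fun k => u k + v k) l (a + b) := fun ξ => by
  simpa using (hu ξ).add (hv ξ)

theorem WTendsto.sub (hu : WTendsto ι u l a) (hv : WTendsto ι v l b) :
    WTendsto ι (fun k => u k - v k) l (a - b) := fun ξ => by
  simpa using (hu ξ).sub (hv ξ)

theorem WTendsto.const_smul (hu : WTendsto ι u l a) (c : ℂ) :
    WTendsto ι (fun k => c • u k) l (c • a) := fun ξ => by
  simpa using (hu ξ).const_mul c

theorem WTendsto.const (a : A) : WTendsto ι (fun _ => a) l a := fun _ => tendsto_const_nhds

theorem WTendsto.sum {n : ℕ} {u : ℕ → κ → A} {a : ℕ → A} (h : ∀ j, WTendsto ι (u j) l (a j)) :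
    WTendsto ι (fun k => ∑ j ∈ Finset.range n, u j k) l (∑ j ∈ Finset.range n, a j) := by
  induction n with
  | zero => simpa using WTendsto.const (0 : A)
  | succ n ih => simpa only [Finset.sum_range_succ] using ih.add (h n)

theorem WTendsto.unique [NeBot l] (hu : WTendsto ι u l a) (hv : WTendsto ι u l b) : a = b := by
  refine ι.injective (ContinuousLinearMap.ext fun ξ => ?_)
  exact tendsto_nhds_unique (hu ξ) (hv ξ)

theorem WTendsto.norm_le [NeBot l] {C : ℝ} (hu : WTendsto ι u l a) (hC : ∀ k, ‖u k‖ ≤ C) :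
    ‖a‖ ≤ C := by
  have hC0 : 0 ≤ C := by
    obtain ⟨k⟩ := l.nonempty_of_neBot
    exact (norm_nonneg _).trans (hC k)
  rw [← ι.norm_map]
  refine ContinuousLinearMap.opNorm_le_bound _ hC0 fun ξ => ?_
  refine le_of_tendsto (hu ξ).norm (Eventually.of_forall fun k => ?_)
  refine ((ι (u k)).le_opNorm ξ).trans ?_
  rw [ι.norm_map]
  exact mul_le_mul_of_nonneg_right (hC k) (norm_nonneg _)

theorem exists_wTendsto (ι : A ≃ₗᵢ[ℂ] StrongDual ℂ X) (l : Ultrafilter κ) {C : ℝ}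
    (hC : ∀ k, ‖u k‖ ≤ C) : ∃ a, WTendsto ι u l a := by
  have hK := WeakDual.isCompact_closedBall (𝕜 := ℂ) (E := X) 0 C
  obtain ⟨z, -, hz⟩ := hK.ultrafilter_le_nhds
    (l.map fun k => StrongDual.toWeakDual (ι (u k))) (by
      rw [le_principal_iff, Ultrafilter.mem_coe, Ultrafilter.mem_map]
      refine univ_mem' fun k => ?_
      simpa using hC k)
  refine ⟨ι.symm (WeakDual.toStrongDual z), fun ξ => ?_⟩
  have h1 : Tendsto (fun k => StrongDual.toWeakDual (ι (u k))) l (𝓝 z) := hz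
  rw [ι.apply_symm_apply]
  exact ((WeakDual.eval_continuous ξ).tendsto z).comp h1

theorem mul_eq_zero_of_wTendsto [PartialOrder A] [StarOrderedRing A] [NeBot l] {c w : A}
    (hc0 : 0 ≤ c) (hc1 : c ≤ 1) (hca : c * a = 0) {K : ℝ} (hK : ∀ k, ‖a * u k‖ ≤ K)
    (hw : WTendsto ι (fun k => a * u k) l w) : c * w = 0 := by
  have hcs : star c = c := (IsSelfAdjoint.of_nonneg hc0).star_eq
  have hac : star a * c = 0 := by
    rw [← hcs, ← star_mul, hca, star_zero]
  have key : ∀ r : ℝ, 0 ≤ r → (1 + r) ^ 2 * ‖c * w‖ ^ 2 ≤ K ^ 2 + r ^ 2 * ‖c * w‖ ^ 2 := by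
    intro r hr
    have hlim : WTendsto ι (fun k => a * u k + (r : ℂ) • (c * w)) l (w + (r : ℂ) • (c * w)) :=
      hw.add (WTendsto.const _)
    have h1 : ∀ k, ‖a * u k + (r : ℂ) • (c * w)‖ ≤ √(K ^ 2 + r ^ 2 * ‖c * w‖ ^ 2) := by
      intro k
      refine Real.le_sqrt_of_sq_le ?_
      have hx : star (a * u k) * (c * w) = 0 := by
        rw [star_mul, mul_assoc, ← mul_assoc (star a), hac, zero_mul, mul_zero]
      have hx' : star (c * w) * (a * u k) = 0 := by
        have := congrArg star hx
        rwa [star_mul, star_star, star_zero] at this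
      have e : star (a * u k + (r : ℂ) • (c * w)) * (a * u k + (r : ℂ) • (c * w)) =
          star (a * u k) * (a * u k) + ((r : ℂ) * r) • (star (c * w) * (c * w)) := by
        simp only [star_add, star_smul, add_mul, mul_add, mul_smul_comm, smul_mul_assoc, hx, hx',
          smul_zero, add_zero, zero_add, smul_smul]
        simp
      rw [sq, ← CStarRing.norm_star_mul_self, e]
      refine (norm_add_le _ _).trans ?_
      rw [norm_smul, CStarRing.norm_star_mul_self, CStarRing.norm_star_mul_self]
      simp only [norm_mul, Complex.norm_real, Real.norm_eq_abs, abs_mul_abs_self]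
      have := mul_self_le_mul_self (norm_nonneg _) (hK k)
      nlinarith
    have h2 := hlim.norm_le h1
    have h3 : ‖((1 + r : ℝ) : ℂ) • (c * w)‖ ≤ ‖w + (r : ℂ) • (c * w)‖ := by
      have e1 : star (((1 + r : ℝ) : ℂ) • (c * w)) * (((1 + r : ℝ) : ℂ) • (c * w)) =
          star w * (((1 + r : ℝ) : ℂ) • c * (((1 + r : ℝ) : ℂ) • c)) * w := by
        simp only [star_smul, star_mul, hcs, smul_mul_assoc, mul_smul_comm, mul_assoc]
        simp
      have e2 : star (w + (r : ℂ) • (c * w)) * (w + (r : ℂ) • (c * w)) =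
          star w * ((1 + (r : ℂ) • c) * (1 + (r : ℂ) • c)) * w := by
        have : w + (r : ℂ) • (c * w) = (1 + (r : ℂ) • c) * w := by
          rw [add_mul, one_mul, smul_mul_assoc]
        rw [this, star_mul, star_add, star_one, star_smul, hcs]
        simp [mul_assoc]
      have hcc : 0 ≤ c * (1 - c) :=
        Commute.mul_nonneg hc0 (sub_nonneg.2 hc1)
          ((Commute.one_right c).sub_right (Commute.refl c))
      have e3 : ((1 + r : ℝ) : ℂ) • c * (((1 + r : ℝ) : ℂ) • c) ≤
          (1 + (r : ℂ) • c) * (1 + (r : ℂ) • c) := by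
        rw [← sub_nonneg]
        have e : (1 + (r : ℂ) • c) * (1 + (r : ℂ) • c) -
            ((1 + r : ℝ) : ℂ) • c * (((1 + r : ℝ) : ℂ) • c) =
            (1 - c) + ((1 + 2 * r : ℝ) : ℂ) • (c * (1 - c)) := by
          simp only [mul_add, add_mul, mul_sub, smul_mul_assoc, mul_smul_comm, one_mul, mul_one]
          push_cast
          module
        rw [e]
        refine add_nonneg (sub_nonneg.2 hc1) (smul_nonneg ?_ hcc)
        exact_mod_cast (by linarith : (0 : ℝ) ≤ 1 + 2 * r)
      refine le_of_sq_le_sq ?_ (norm_nonneg _)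
      rw [sq, sq, ← CStarRing.norm_star_mul_self, ← CStarRing.norm_star_mul_self]
      refine CStarAlgebra.norm_le_norm_of_nonneg_of_le (star_mul_self_nonneg _) ?_
      rw [e1, e2]
      exact star_left_conjugate_le_conjugate e3 w
    rw [norm_smul, Complex.norm_real, Real.norm_of_nonneg (by linarith)] at h3
    have h4 := h3.trans h2
    have h5 := pow_le_pow_left₀ (by positivity) h4 2
    rwa [Real.sq_sqrt (by positivity), mul_pow] at h5
  have h0 : ‖c * w‖ = 0 := by
    by_contra hne
    have hpos : 0 < ‖c * w‖ ^ 2 := by positivity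
    have := key (K ^ 2 / ‖c * w‖ ^ 2) (by positivity)
    have e : K ^ 2 / ‖c * w‖ ^ 2 * ‖c * w‖ ^ 2 = K ^ 2 := div_mul_cancel₀ _ hpos.ne'
    nlinarith [sq_nonneg K]
  exact norm_eq_zero.1 h0

theorem norm_sum_sq_le_of_orthogonal {e : ℕ → A} {D : ℝ} (hD : ∀ k, ‖e k‖ ≤ D)
    (horth : ∀ j k, j + 2 ≤ k → star (e j) * e k = 0) (n : ℕ) :
    ‖∑ k ∈ Finset.range n, e k‖ ^ 2 ≤ 3 * D ^ 2 * n := by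
  have hsq : ∀ k, ‖e k‖ * ‖e k‖ ≤ D ^ 2 := fun k => by
    rw [sq]
    exact mul_self_le_mul_self (norm_nonneg _) (hD k)
  have hx : ∀ n, ‖star (∑ k ∈ Finset.range n, e k) * e n‖ ≤ D ^ 2 := by
    intro n
    rcases n with _ | n
    · simpa using sq_nonneg D
    · rw [Finset.sum_range_succ, star_add, add_mul, star_sum, Finset.sum_mul,
        Finset.sum_eq_zero fun j hj => horth j (n + 1) (by have := Finset.mem_range.1 hj; omega),
        zero_add]
      refine (norm_mul_le _ _).trans ?_
      rw [norm_star, sq]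
      exact mul_le_mul (hD n) (hD _) (norm_nonneg _) ((norm_nonneg _).trans (hD n))
  induction n with
  | zero => simp
  | succ n ih =>
    set S := ∑ k ∈ Finset.range n, e k with hS
    have h1 : star (S + e n) * (S + e n) =
        star S * S + star S * e n + star (star S * e n) + star (e n) * e n := by
      rw [star_mul, star_star, star_add, add_mul, mul_add, mul_add]
      abel
    rw [Finset.sum_range_succ, ← hS, sq, ← CStarRing.norm_star_mul_self, h1]
    refine (norm_add₄_le).trans ?_
    rw [norm_star, CStarRing.norm_star_mul_self, CStarRing.norm_star_mul_self]
    have := hx n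
    have := hsq n
    push_cast
    nlinarith

theorem exists_layers [PartialOrder A] [StarOrderedRing A] (ha0 : 0 ≤ a) (ha1 : a ≤ 1)
    (N : ℕ) : ∃ g : ℕ → A, (∀ k, 0 ≤ g k ∧ g k ≤ 1) ∧
      (∀ j k, j < k → g k * g j = g k ∧ g j * g k = g k) ∧
      ∑ k ∈ Finset.range N, g (k + 1) = (N : ℝ) • a := by
  have hsa : IsSelfAdjoint a := IsSelfAdjoint.of_nonneg ha0
  have hspec0 : ∀ s ∈ spectrum ℝ a, 0 ≤ s := fun s hs => spectrum_nonneg_of_nonneg ha0 hs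
  have hspec1 : ∀ s ∈ spectrum ℝ a, s ≤ 1 := by
    have := (le_algebraMap_iff_spectrum_le (r := (1 : ℝ)) (a := a)).1 (by simpa using ha1)
    exact this
  let f : ℕ → ℝ → ℝ := fun k s => max 0 (min 1 (N * s - k + 1))
  have hf : ∀ k, Continuous (f k) := fun k => by fun_prop
  refine ⟨fun k => cfc (f k) a, fun k => ⟨cfc_nonneg fun s _ => le_max_left _ _,
    cfc_le_one _ _ fun s _ => max_le zero_le_one (min_le_left _ _)⟩, fun j k hjk => ?_, ?_⟩
  · have hjk' : (j : ℝ) + 1 ≤ k := by exact_mod_cast hjk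
    have h : ∀ s, f k s * f j s = f k s := fun s => by
      simp only [f]
      rcases le_total (N * s - k + 1) 0 with h | h
      · rw [max_eq_left ((min_le_right _ _).trans h), zero_mul]
      · rw [min_eq_left (by linarith : (1 : ℝ) ≤ N * s - j + 1), max_eq_right zero_le_one, mul_one]
    constructor
    · rw [← cfc_mul (f k) (f j) a (hf k).continuousOn (hf j).continuousOn]
      exact congrArg (cfc · a) (funext h)
    · rw [← cfc_mul (f j) (f k) a (hf j).continuousOn (hf k).continuousOn]
      exact congrArg (cfc · a) (funext fun s => (mul_comm _ _).trans (h s))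
  · have hsum : ∀ (n : ℕ) (s : ℝ), 0 ≤ N * s →
        ∑ k ∈ Finset.range n, f (k + 1) s = min (N * s) n := by
      intro n s hs
      induction n with
      | zero => simpa using hs
      | succ n ih =>
        rw [Finset.sum_range_succ, ih]
        simp only [f]
        push_cast
        rw [show N * s - (n + 1) + 1 = N * s - n by ring]
        rcases le_total (N * s) n with h | h
        · rw [min_eq_left h, max_eq_left ((min_le_right _ _).trans (by linarith)),
            min_eq_left (by linarith), add_zero]
        · rw [min_eq_right h, max_eq_right (le_min zero_le_one (by linarith)), ← min_add_add_left]
          rw [min_comm]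
          congr 1
          ring
    rw [← cfc_sum (fun k => f (k + 1)) a (Finset.range N) fun k _ => (hf _).continuousOn,
      ← cfc_const_mul_id (N : ℝ) a]
    refine cfc_congr fun s hs => ?_
    rw [Finset.sum_apply, hsum N s (mul_nonneg N.cast_nonneg (hspec0 s hs)), min_eq_left]
    exact mul_le_of_le_one_right N.cast_nonneg (hspec1 s hs)

theorem norm_le_one_of_mem_Icc [PartialOrder A] [StarOrderedRing A] (h : 0 ≤ a ∧ a ≤ 1) :
    ‖a‖ ≤ 1 :=
  (CStarAlgebra.norm_le_one_iff_of_nonneg a h.1).2 h.2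

theorem WTendsto.mul_left_of_le_one [PartialOrder A] [StarOrderedRing A] {l : Ultrafilter κ}
    (ha0 : 0 ≤ a) (ha1 : a ≤ 1) {C : ℝ} (hC : ∀ k, ‖u k‖ ≤ C) {y : A} (hu : WTendsto ι u l y) :
    WTendsto ι (fun k => a * u k) l (a * y) := by
  have hmul : ∀ {b : A}, 0 ≤ b ∧ b ≤ 1 → ∀ k, ‖b * u k‖ ≤ C := fun hb k =>
    (norm_mul_le _ _).trans ((mul_le_of_le_one_left (norm_nonneg _)
      (norm_le_one_of_mem_Icc hb)).trans (hC k))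
  obtain ⟨z, hz⟩ := exists_wTendsto ι l (hmul ⟨ha0, ha1⟩)
  have hCy : ‖y‖ ≤ C := hu.norm_le hC
  have hC0 : 0 ≤ C := (norm_nonneg _).trans hCy
  have key : ∀ N : ℕ, ‖(N : ℂ) • (a * y - z)‖ ^ 2 ≤ 3 * (2 * C) ^ 2 * N := by
    intro N
    obtain ⟨g, hg, hgg, hsum⟩ := exists_layers ha0 ha1 N
    have hsum' : ∑ k ∈ Finset.range N, g (k + 1) = (N : ℂ) • a := by
      rw [hsum]
      norm_cast
    choose w hw using fun k => exists_wTendsto ι l (hmul (hg k))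
    have h1 : ∀ j k, j < k → g j * w k = w k := by
      intro j k hjk
      have := mul_eq_zero_of_wTendsto (c := 1 - g j) (sub_nonneg.2 (hg j).2)
        (sub_le_self _ (hg j).1) (by rw [sub_mul, one_mul, (hgg j k hjk).2, sub_self])
        (hmul (hg k)) (hw k)
      rw [sub_mul, one_mul, sub_eq_zero] at this
      exact this.symm
    have h2 : ∀ j k, j < k → g k * w j = g k * y := by
      intro j k hjk
      have h3 : 0 ≤ 1 - g j ∧ 1 - g j ≤ 1 := ⟨sub_nonneg.2 (hg j).2, sub_le_self _ (hg j).1⟩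
      have := mul_eq_zero_of_wTendsto (c := g k) (a := 1 - g j) (w := y - w j) (hg k).1 (hg k).2
        (by rw [mul_sub, mul_one, (hgg j k hjk).1, sub_self]) (hmul h3)
        (by simpa only [sub_mul, one_mul] using hu.sub (hw j))
      rw [mul_sub, sub_eq_zero] at this
      exact this.symm
    have hz' : (N : ℂ) • z = ∑ k ∈ Finset.range N, w (k + 1) := by
      refine (hz.const_smul (N : ℂ)).unique ?_
      have := WTendsto.sum (n := N) fun j => hw (j + 1)
      simpa only [← Finset.sum_mul, hsum', smul_mul_assoc] using this
    have he : (N : ℂ) • (a * y - z) =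
        ∑ k ∈ Finset.range N, (g (k + 1) * y - w (k + 1)) := by
      rw [Finset.sum_sub_distrib, ← hz', ← Finset.sum_mul, hsum', smul_mul_assoc, smul_sub]
    rw [he]
    refine norm_sum_sq_le_of_orthogonal (fun k => ?_) (fun j k hjk => ?_) N
    · refine (norm_sub_le _ _).trans ?_
      have h3 : ‖g (k + 1) * y‖ ≤ C := (norm_mul_le _ _).trans
        ((mul_le_of_le_one_left (norm_nonneg _) (norm_le_one_of_mem_Icc (hg _))).trans hCy)
      have h4 : ‖w (k + 1)‖ ≤ C := (hw (k + 1)).norm_le (hmul (hg _))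
      linarith
    · have h3 : g (k + 1) * y - w (k + 1) = g k * (g (k + 1) * y - w (k + 1)) := by
        rw [mul_sub, ← mul_assoc, (hgg k (k + 1) k.lt_succ_self).2, h1 _ _ k.lt_succ_self]
      have h4 : g k * (g (j + 1) * y - w (j + 1)) = 0 := by
        rw [mul_sub, ← mul_assoc, (hgg (j + 1) k (by omega)).1, h2 (j + 1) k (by omega), sub_self]
      have hs : star (g k) = g k := (IsSelfAdjoint.of_nonneg (hg k).1).star_eq
      have h5 := congrArg star h4
      rw [star_mul, hs, star_zero] at h5
      rw [h3, ← mul_assoc, h5, zero_mul]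
  have h0 : ‖a * y - z‖ = 0 := by
    by_contra hne
    have hpos : 0 < ‖a * y - z‖ ^ 2 := by positivity
    obtain ⟨N, hN⟩ := exists_nat_gt (3 * (2 * C) ^ 2 / ‖a * y - z‖ ^ 2)
    rw [div_lt_iff₀ hpos] at hN
    have hN0 : (0 : ℝ) < N := by
      by_contra h
      have : (N : ℝ) = 0 := le_antisymm (not_lt.1 h) N.cast_nonneg
      rw [this, zero_mul] at hN
      nlinarith [sq_nonneg C]
    have := key N
    rw [norm_smul, Complex.norm_natCast, mul_pow] at this
    nlinarith
  rwa [sub_eq_zero.1 (norm_eq_zero.1 h0)]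

/-- Left multiplication is weak-⋆ continuous on bounded sets. -/
theorem WTendsto.mul_left {C : ℝ} (hC : ∀ k, ‖u k‖ ≤ C) {y : A} (hu : WTendsto ι u l y) (a : A) :
    WTendsto ι (fun k => a * u k) l (a * y) := by
  let := CStarAlgebra.spectralOrder A
  let := CStarAlgebra.spectralOrderedRing A
  suffices h : ∀ l : Ultrafilter κ, WTendsto ι u l y → WTendsto ι (fun k => a * u k) l (a * y) by
    intro ξ
    rw [tendsto_iff_ultrafilter]
    exact fun l' hl' => h l' (fun ξ => (hu ξ).mono_left hl') ξ
  intro l hu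
  have ha : a ∈ Submodule.span ℂ {a : A | 0 ≤ a} := by
    rw [CStarAlgebra.span_nonneg]
    trivial
  induction ha using Submodule.span_induction with
  | mem b hb =>
    have hb0 : 0 ≤ b := hb
    set r : ℝ := ‖b‖ + 1 with hr
    have hr0 : 0 < r := by positivity
    have h1 : 0 ≤ (r⁻¹ : ℝ) • b := smul_nonneg (by positivity) hb0
    have h2 : (r⁻¹ : ℝ) • b ≤ 1 := by
      rw [← CStarAlgebra.norm_le_one_iff_of_nonneg _ h1, norm_smul, Real.norm_of_nonneg
        (by positivity), inv_mul_le_one₀ hr0]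
      linarith
    have h3 := (WTendsto.mul_left_of_le_one h1 h2 hC hu).const_smul (r : ℂ)
    have e : ∀ x : A, (r : ℂ) • ((r⁻¹ : ℝ) • b * x) = b * x := fun x => by
      rw [Complex.coe_smul, smul_mul_assoc, smul_inv_smul₀ hr0.ne']
    simpa only [e] using h3
  | zero => simpa using WTendsto.const (0 : A)
  | add b c _ _ hb hc => simpa only [add_mul] using hb.add hc
  | smul r b _ hb => simpa only [smul_mul_assoc] using hb.const_smul r

/-- Right multiplication is weak-⋆ continuous on bounded sets. -/
theorem WTendsto.mul_right {C : ℝ} (hC : ∀ k, ‖u k‖ ≤ C) {y : A} (hu : WTendsto ι u l y) (a : A) :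
    WTendsto ι (fun k => u k * a) l (y * a) := by
  let e : Aᵐᵒᵖ ≃ₗᵢ[ℂ] A := ⟨(MulOpposite.opLinearEquiv ℂ).symm, fun _ => rfl⟩
  exact WTendsto.mul_left (ι := e.trans ι) (u := fun k => MulOpposite.op (u k))
    (y := MulOpposite.op y) hC hu (MulOpposite.op a)

end WeakStar

end MomentPoly

namespace MomentPoly

/-! ### Normal functionals -/

section Normal

variable {A : Type*} [CStarAlgebra A]
variable {X : Type*} [NormedAddCommGroup X] [NormedSpace ℂ X]

/-- The element `ξ` of the predual as a functional. -/
noncomputable def evalCLM (ι : A ≃ₗᵢ[ℂ] StrongDual ℂ X) : X →L[ℂ] StrongDual ℂ A :=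
  ContinuousLinearMap.flip (ι.toContinuousLinearEquiv : A →L[ℂ] StrongDual ℂ X)

@[simp] theorem evalCLM_apply (ι : A ≃ₗᵢ[ℂ] StrongDual ℂ X) (ξ : X) (a : A) :
    evalCLM ι ξ a = ι a ξ := rfl

variable {ι : A ≃ₗᵢ[ℂ] StrongDual ℂ X}

theorem norm_apply_le (a : A) (ξ : X) : ‖ι a ξ‖ ≤ ‖a‖ * ‖ξ‖ := by
  simpa using (ι a).le_opNorm ξ

theorem norm_le_of_forall_apply_le {ξ : X} {M : ℝ} (hM : 0 ≤ M)
    (h : ∀ a : A, ‖ι a ξ‖ ≤ M * ‖a‖) : ‖ξ‖ ≤ M := by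
  refine NormedSpace.norm_le_dual_bound ℂ ξ hM fun f => ?_
  simpa using h (ι.symm f)

theorem eq_of_forall_apply_eq {ξ η : X} (h : ∀ a : A, ι a ξ = ι a η) : ξ = η := by
  rw [← sub_eq_zero, ← norm_le_zero_iff]
  exact norm_le_of_forall_apply_le (ι := ι) le_rfl fun a => by simp [h a]

theorem isClosed_range_evalCLM [CompleteSpace X] : IsClosed (Set.range (evalCLM ι)) := by
  have h : AntilipschitzWith 1 (evalCLM ι) := by
    refine ContinuousLinearMap.antilipschitz_of_bound _ fun ξ => ?_
    rw [NNReal.coe_one, one_mul]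
    exact norm_le_of_forall_apply_le (ι := ι) (norm_nonneg _) fun a => (evalCLM ι ξ).le_opNorm a
  exact h.isClosed_range (evalCLM ι).uniformContinuous

/-- The Krein–Šmulian theorem for functionals: a bounded functional which is weak-⋆ continuous at
zero on the unit ball comes from the predual. -/
theorem exists_eq_apply_of_ball [CompleteSpace X] (f : StrongDual ℂ A)
    (hf : ∀ u : Finset X → A, (∀ F, ‖u F‖ ≤ 1) → WTendsto ι u atTop 0 →
      Tendsto (fun F => f (u F)) atTop (𝓝 0)) : ∃ ξ, ∀ a, f a = ι a ξ := by
  suffices h : f ∈ closure (Set.range (evalCLM ι)) by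
    obtain ⟨ξ, rfl⟩ := (isClosed_range_evalCLM (ι := ι)).closure_eq ▸ h
    exact ⟨ξ, fun _ => rfl⟩
  rw [Metric.mem_closure_iff]
  intro ε hε
  obtain ⟨F, hF⟩ : ∃ F : Finset X, ∀ a : A, ‖a‖ ≤ 1 → (∀ ξ ∈ F, ι a ξ = 0) → ‖f a‖ ≤ ε / 2 := by
    by_contra! hcon
    choose u hu1 hu2 hu3 using hcon
    have h1 : WTendsto ι u atTop 0 := fun ξ => by
      refine tendsto_const_nhds.congr' ?_
      filter_upwards [eventually_ge_atTop {ξ}] with F hF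
      rw [hu2 F ξ (hF (Finset.mem_singleton_self ξ))]
      simp
    obtain ⟨F, hF⟩ := ((hf u hu1 h1).norm.eventually_lt_const
      (by rw [norm_zero]; exact half_pos hε)).exists
    exact (hu3 F).not_gt hF
  let p : Submodule ℂ A := ⨅ ξ : F, LinearMap.ker (evalCLM ι ξ : A →ₗ[ℂ] ℂ)
  have hp : ∀ a ∈ p, ∀ ξ ∈ F, ι a ξ = 0 := fun a ha ξ hξ => by
    have := (Submodule.mem_iInf _).1 ha ⟨ξ, hξ⟩
    simpa using this
  obtain ⟨g, hg, hgn⟩ := exists_extension_norm_eq p (f.comp p.subtypeL)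
  have hgle : ‖g‖ ≤ ε / 2 := by
    rw [hgn]
    refine ContinuousLinearMap.opNorm_le_of_unit_norm (by positivity) fun a ha => ?_
    exact hF a ha.le (hp a a.2)
  have hmem : ((f - g : StrongDual ℂ A) : A →ₗ[ℂ] ℂ) ∈
      Submodule.span ℂ (Set.range fun ξ : F => (evalCLM ι ξ : A →ₗ[ℂ] ℂ)) := by
    refine mem_span_of_iInf_ker_le_ker fun a ha => ?_
    have := hg ⟨a, ha⟩
    simp only [ContinuousLinearMap.comp_apply, Submodule.subtypeL_apply] at this
    simp [this]
  have hle : Submodule.span ℂ (Set.range fun ξ : F => (evalCLM ι ξ : A →ₗ[ℂ] ℂ)) ≤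
      LinearMap.range ((ContinuousLinearMap.coeLM ℂ).comp (evalCLM ι : X →ₗ[ℂ] StrongDual ℂ A)) := by
    rw [Submodule.span_le]
    rintro _ ⟨ξ, rfl⟩
    exact ⟨ξ, rfl⟩
  obtain ⟨ξ, hξ⟩ := hle hmem
  refine ⟨evalCLM ι ξ, ⟨ξ, rfl⟩, ?_⟩
  have : f - evalCLM ι ξ = g := by
    ext a
    have := congrArg (fun h : A →ₗ[ℂ] ℂ => h a) hξ
    simp only [LinearMap.comp_apply, ContinuousLinearMap.coe_coe, ContinuousLinearMap.coeLM_apply,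
      sub_apply] at this
    rw [sub_apply, this]
    ring
  rw [dist_eq_norm, this]
  linarith

/-- The ultraweakly continuous functionals are those given by the predual. -/
theorem continuous_ultraweak_iff (f : A →ₗ[ℂ] ℂ) :
    Continuous[ultraweak ι, inferInstance] f ↔ ∃ ξ, ∀ a, f a = ι a ξ := by
  have h : ultraweak ι = ⨅ ξ : X, TopologicalSpace.induced
      (evalCLM ι ξ : A →ₗ[ℂ] ℂ) inferInstance := induced_to_pi _
  rw [h, ← LinearMap.mem_span_iff_continuous (f := fun ξ => (evalCLM ι ξ : A →ₗ[ℂ] ℂ))]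
  constructor
  · intro hf
    have hle : Submodule.span ℂ (Set.range fun ξ : X => (evalCLM ι ξ : A →ₗ[ℂ] ℂ)) ≤
        LinearMap.range
          ((ContinuousLinearMap.coeLM ℂ).comp (evalCLM ι : X →ₗ[ℂ] StrongDual ℂ A)) := by
      rw [Submodule.span_le]
      rintro _ ⟨ξ, rfl⟩
      exact ⟨ξ, rfl⟩
    obtain ⟨ξ, rfl⟩ := hle hf
    exact ⟨ξ, fun _ => rfl⟩
  · rintro ⟨ξ, hξ⟩
    exact Submodule.subset_span ⟨ξ, (LinearMap.ext hξ).symm⟩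

/-- The predual is invariant under multiplication. -/
theorem exists_apply_mul_mul_eq [CompleteSpace X] (b c : A) (ξ : X) :
    ∃ η, ∀ a, ι (b * a * c) ξ = ι a η := by
  refine exists_eq_apply_of_ball
    (((evalCLM ι ξ).comp ((ContinuousLinearMap.mul ℂ A).flip c)).comp
      (ContinuousLinearMap.mul ℂ A b)) fun u hu h => ?_
  have h1 := (h.mul_left hu b).mul_right (C := ‖b‖)
    (fun k => (norm_mul_le _ _).trans (mul_le_of_le_one_right (norm_nonneg _) (hu k))) c
  simpa using h1 ξ

variable [PartialOrder A] [StarOrderedRing A]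

theorem PositiveNormal.continuous_iff {ψ : A →ₚ[ℂ] ℂ} :
    Continuous[ultraweak ι, inferInstance] ψ ↔ ∃ ξ, ∀ a, ψ a = ι a ξ :=
  continuous_ultraweak_iff ψ.toLinearMap

/-- The functional `a ↦ ψ (b⋆ a b)`. -/
noncomputable def conjFunctional (ψ : A →ₚ[ℂ] ℂ) (b : A) : A →ₚ[ℂ] ℂ :=
  PositiveLinearMap.mk₀ ((ψ.toLinearMap.comp (LinearMap.mulRight ℂ b)).comp
    (LinearMap.mulLeft ℂ (star b))) fun a ha => by
      simpa using map_nonneg ψ (star_left_conjugate_nonneg ha b)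

theorem conjFunctional_apply (ψ : A →ₚ[ℂ] ℂ) (b a : A) :
    conjFunctional ψ b a = ψ (star b * a * b) := rfl

theorem continuous_conjFunctional [CompleteSpace X] {ψ : A →ₚ[ℂ] ℂ}
    (hψ : Continuous[ultraweak ι, inferInstance] ψ) (b : A) :
    Continuous[ultraweak ι, inferInstance] (conjFunctional ψ b) := by
  obtain ⟨ξ, hξ⟩ := PositiveNormal.continuous_iff.1 hψ
  obtain ⟨η, hη⟩ := exists_apply_mul_mul_eq (ι := ι) (star b) b ξ
  exact PositiveNormal.continuous_iff.2 ⟨η, fun a => by rw [conjFunctional_apply, hξ, hη]⟩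

/-- The composition of a positive functional with a completely positive map. -/
noncomputable def compFunctional (ψ : A →ₚ[ℂ] ℂ) (φ : A →CP A) : A →ₚ[ℂ] ℂ :=
  PositiveLinearMap.mk₀ (ψ.toLinearMap.comp φ.toLinearMap) fun a ha =>
    map_nonneg ψ (show 0 ≤ φ a from map_nonneg φ ha)

theorem compFunctional_apply (ψ : A →ₚ[ℂ] ℂ) (φ : A →CP A) (a : A) :
    compFunctional ψ φ a = ψ (φ a) := rfl

end Normal

/-! ### The strong topology -/

section Strong

variable {A : Type*} [CStarAlgebra A] [PartialOrder A] [StarOrderedRing A]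
variable {X : Type*} [NormedAddCommGroup X] [NormedSpace ℂ X]
variable {ι : A ≃ₗᵢ[ℂ] StrongDual ℂ X}
variable {κ : Type*} {u v : κ → A} {l : Filter κ} {a b : A}

theorem tendsto_zero_of_nonneg_of_le {f g : κ → ℂ} (h0 : ∀ k, 0 ≤ f k) (h : ∀ k, f k ≤ g k)
    (hg : Tendsto g l (𝓝 0)) : Tendsto f l (𝓝 0) :=
  squeeze_zero_norm (fun k => CStarAlgebra.norm_le_norm_of_nonneg_of_le (h0 k) (h k))
    (by simpa using hg.norm)

theorem strongTendsto_iff_sub :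
    StrongTendsto ι u l a ↔ StrongTendsto ι (fun k => u k - a) l 0 := by
  simp [StrongTendsto]

theorem StrongTendsto.const (a : A) : StrongTendsto ι (fun _ => a) l a := fun ψ _ => by
  simp [tendsto_const_nhds]

theorem StrongTendsto.add (hu : StrongTendsto ι u l a) (hv : StrongTendsto ι v l b) :
    StrongTendsto ι (fun k => u k + v k) l (a + b) := by
  intro ψ hψ
  have h1 := ((hu ψ hψ).add (hv ψ hψ)).const_mul 2
  rw [add_zero, mul_zero] at h1
  refine tendsto_zero_of_nonneg_of_le (fun k => map_nonneg ψ (star_mul_self_nonneg _))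
    (fun k => ?_) h1
  set x := u k - a
  set y := v k - b
  have e : star (u k + v k - (a + b)) * (u k + v k - (a + b)) =
      (star x * x + star y * y) + (star x * x + star y * y) - star (x - y) * (x - y) := by
    rw [show u k + v k - (a + b) = x + y by simp only [x, y]; abel]
    simp only [star_add, star_sub, add_mul, mul_add, sub_mul, mul_sub]
    abel
  rw [e, map_sub, map_add, map_add, ← two_mul, sub_le_self_iff]
  exact map_nonneg ψ (star_mul_self_nonneg _)

theorem StrongTendsto.neg (hu : StrongTendsto ι u l a) :
    StrongTendsto ι (fun k => - u k) l (-a) := by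
  intro ψ hψ
  refine (hu ψ hψ).congr fun k => ?_
  rw [show -u k - -a = -(u k - a) by abel, star_neg, neg_mul_neg]

theorem StrongTendsto.sub (hu : StrongTendsto ι u l a) (hv : StrongTendsto ι v l b) :
    StrongTendsto ι (fun k => u k - v k) l (a - b) := by
  simpa only [sub_eq_add_neg] using hu.add hv.neg

theorem StrongTendsto.zsmul (hu : StrongTendsto ι u l a) (n : ℤ) :
    StrongTendsto ι (fun k => n • u k) l (n • a) := by
  intro ψ hψ
  have h := (hu ψ hψ).const_mul ((n * n : ℤ) : ℂ)
  rw [mul_zero] at h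
  refine h.congr fun k => ?_
  rw [← smul_sub, star_zsmul, smul_mul_smul_comm, map_zsmul, zsmul_eq_mul]

theorem StrongTendsto.sum {σ : Type*} {s : Finset σ} {u : σ → κ → A} {a : σ → A}
    (h : ∀ j ∈ s, StrongTendsto ι (u j) l (a j)) :
    StrongTendsto ι (fun k => ∑ j ∈ s, u j k) l (∑ j ∈ s, a j) := by
  induction s using Finset.cons_induction with
  | empty => simpa using StrongTendsto.const (0 : A)
  | cons j s hj ih =>
    simp only [Finset.sum_cons]
    exact (h j (Finset.mem_cons_self j s)).add
      (ih fun i hi => h i (Finset.mem_cons_of_mem hi))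

theorem StrongTendsto.mul_left_bounded (hv : StrongTendsto ι v l 0) {C : ℝ}
    (hC : ∀ k, ‖u k‖ ≤ C) : StrongTendsto ι (fun k => u k * v k) l 0 := by
  intro ψ hψ
  have h := (hv ψ hψ).const_mul ((C ^ 2 : ℝ) : ℂ)
  rw [mul_zero] at h
  refine tendsto_zero_of_nonneg_of_le (fun k => map_nonneg ψ (star_mul_self_nonneg _))
    (fun k => ?_) h
  simp only [sub_zero]
  have h1 : star (u k * v k) * (u k * v k) ≤ ‖star (u k) * u k‖ • (star (v k) * v k) := by
    rw [star_mul, mul_assoc, ← mul_assoc (star (u k)), ← mul_assoc]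
    exact CStarAlgebra.star_left_conjugate_le_norm_smul
  have h2 : ψ (‖star (u k) * u k‖ • (star (v k) * v k)) =
      (‖star (u k) * u k‖ : ℂ) * ψ (star (v k) * v k) := by
    rw [← Complex.coe_smul, map_smul, smul_eq_mul]
  refine (OrderHomClass.mono ψ h1).trans (h2.le.trans ?_)
  refine mul_le_mul_of_nonneg_right ?_ (map_nonneg ψ (star_mul_self_nonneg _))
  rw [CStarRing.norm_star_mul_self, ← sq]
  exact_mod_cast pow_le_pow_left₀ (norm_nonneg _) (hC k) 2

theorem StrongTendsto.mul [CompleteSpace X] (hu : StrongTendsto ι u l a)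
    (hv : StrongTendsto ι v l b) {C : ℝ} (hC : ∀ k, ‖u k‖ ≤ C) :
    StrongTendsto ι (fun k => u k * v k) l (a * b) := by
  rw [strongTendsto_iff_sub]
  have h1 := (strongTendsto_iff_sub.1 hv).mul_left_bounded hC
  have h2 : StrongTendsto ι (fun k => (u k - a) * b) l 0 := by
    intro ψ hψ
    refine (hu _ (continuous_conjFunctional hψ b)).congr fun k => ?_
    rw [conjFunctional_apply, sub_zero, star_mul]
    simp only [mul_assoc]
  simpa only [mul_sub, sub_mul, sub_add_sub_cancel, add_zero] using h1.add h2

theorem strongTendsto_algebraMap {c : κ → ℂ} {z : ℂ} (h : Tendsto c l (𝓝 z)) :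
    StrongTendsto ι (fun k => algebraMap ℂ A (c k)) l (algebraMap ℂ A z) := by
  intro ψ _
  have h1 : Tendsto (fun k => star (c k - z) * (c k - z) * ψ 1) l (𝓝 0) := by
    have h2 : Tendsto (fun k => c k - z) l (𝓝 0) := by simpa using h.sub_const z
    have h3 := ((h2.star.mul h2).mul_const (ψ 1))
    simpa using h3
  refine h1.congr fun k => ?_
  rw [← map_sub, ← algebraMap_star_comm, ← map_mul, Algebra.algebraMap_eq_smul_one, map_smul,
    smul_eq_mul]

theorem norm_sq_apply_le (ψ : A →ₚ[ℂ] ℂ) (h1 : ψ 1 = 1) (x : A) :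
    ((‖ψ x‖ ^ 2 : ℝ) : ℂ) ≤ ψ (star x * x) := by
  have h : 0 ≤ ψ (star (x - algebraMap ℂ A (ψ x)) * (x - algebraMap ℂ A (ψ x))) :=
    map_nonneg ψ (star_mul_self_nonneg _)
  have e : star (x - algebraMap ℂ A (ψ x)) * (x - algebraMap ℂ A (ψ x)) =
      star x * x - ψ x • star x - star (ψ x) • x + (star (ψ x) * ψ x) • (1 : A) := by
    simp only [Algebra.algebraMap_eq_smul_one, star_sub, star_smul, star_one, sub_mul, mul_sub,
      smul_mul_assoc, mul_smul_comm, one_mul, mul_one]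
    module
  rw [e, map_add, map_sub, map_sub, map_smul, map_smul, map_smul, map_star, h1] at h
  simp only [smul_eq_mul, mul_one] at h
  have e2 : ψ x * star (ψ x) = ((‖ψ x‖ ^ 2 : ℝ) : ℂ) := by
    simpa using Complex.mul_conj' (ψ x)
  rw [mul_comm (star (ψ x)), e2] at h
  rw [← sub_nonneg]
  convert h using 1
  ring

theorem StrongTendsto.tendsto_state (hu : StrongTendsto ι u l a) {ω : A →ₚ[ℂ] ℂ}
    (hω : IsFaithfulNormalState ι ω) : Tendsto (fun k => ω (u k)) l (𝓝 (ω a)) := by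
  have h := tendsto_zero_of_nonneg_of_le (f := fun k => ((‖ω (u k - a)‖ ^ 2 : ℝ) : ℂ))
    (fun k => by exact_mod_cast sq_nonneg ‖ω (u k - a)‖)
    (fun k => norm_sq_apply_le ω hω.map_one (u k - a)) (hu ω hω.normal)
  have h2 : Tendsto (fun k => ‖ω (u k - a)‖ ^ 2) l (𝓝 0) := by
    exact (Complex.continuous_re.tendsto 0).comp h
  have h3 := h2.sqrt
  simp only [Real.sqrt_sq (norm_nonneg _), Real.sqrt_zero, map_sub] at h3
  exact tendsto_iff_norm_sub_tendsto_zero.2 h3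

end Strong

end MomentPoly

namespace MomentPoly

/-! ### Semigroups -/

section Schwarz

variable {A : Type*} [CStarAlgebra A] [PartialOrder A] [StarOrderedRing A]

theorem quadratic_nonneg {P : CStarMatrix (Fin 2) (Fin 2) A} (hP : 0 ≤ P) (v : Fin 2 → A) :
    0 ≤ ∑ i, ∑ j, star (v i) * P i j * v j := by
  rw [StarOrderedRing.nonneg_iff] at hP
  induction hP using AddSubmonoid.closure_induction with
  | mem P hP =>
    obtain ⟨Q, rfl⟩ := hP
    have e : ∑ i, ∑ j, star (v i) * (star Q * Q) i j * v j =
        ∑ k, star (∑ i, Q k i * v i) * (∑ j, Q k j * v j) := by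
      simp only [CStarMatrix.mul_apply, CStarMatrix.star_apply, Fin.sum_univ_two, star_add,
        star_mul, mul_add, add_mul, mul_assoc]
      abel
    rw [e]
    exact Finset.sum_nonneg fun k _ => star_mul_self_nonneg _
  | zero => simp
  | add P Q _ _ hP hQ =>
    simpa [mul_add, add_mul, Finset.sum_add_distrib] using add_nonneg hP hQ

/-- The Schwarz inequality for unital completely positive maps. -/
theorem star_map_mul_map_le (φ : A →CP A) (h1 : φ 1 = 1) (y : A) :
    star (φ y) * φ y ≤ φ (star y * y) := by
  let N : CStarMatrix (Fin 2) (Fin 2) A := CStarMatrix.ofMatrix !![1, y; 0, 0]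
  have hP := φ.map_cstarMatrix_nonneg _ (star_mul_self_nonneg N)
  have h := quadratic_nonneg hP ![-φ y, 1]
  have hs : φ (star y) = star (φ y) := map_star φ y
  simp only [CStarMatrix.map_apply, CStarMatrix.mul_apply, CStarMatrix.star_apply,
    Fin.sum_univ_two, N, CStarMatrix.ofMatrix_apply] at h
  simp [h1, hs] at h
  exact h

end Schwarz

section Semigroup

variable {A : Type*} [CStarAlgebra A] [PartialOrder A] [StarOrderedRing A]
variable {X : Type*} [NormedAddCommGroup X] [NormedSpace ℂ X]
variable {ι : A ≃ₗᵢ[ℂ] StrongDual ℂ X} {φ : ℝ≥0 → A →CP A}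

theorem IsCP0Semigroup.exists_predual (hφ : IsCP0Semigroup ι φ) (t : ℝ≥0) (ξ : X) :
    ∃ η, ∀ a, ι (φ t a) ξ = ι a η := by
  refine (continuous_ultraweak_iff ((evalCLM ι ξ : A →ₗ[ℂ] ℂ).comp (φ t).toLinearMap)).1 ?_
  have h : Continuous[ultraweak ι, inferInstance] (evalCLM ι ξ) :=
    (continuous_ultraweak_iff (evalCLM ι ξ : A →ₗ[ℂ] ℂ)).2 ⟨ξ, fun _ => rfl⟩
  exact @Continuous.comp _ _ _ (ultraweak ι) (ultraweak ι) _ (φ t) (evalCLM ι ξ) h (hφ.normal t)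

/-- The predual semigroup. -/
noncomputable def predualMap (hφ : IsCP0Semigroup ι φ) (t : ℝ≥0) (ξ : X) : X :=
  (hφ.exists_predual t ξ).choose

variable (hφ : IsCP0Semigroup ι φ)

theorem apply_predualMap (t : ℝ≥0) (ξ : X) (a : A) :
    ι a (predualMap hφ t ξ) = ι (φ t a) ξ :=
  ((hφ.exists_predual t ξ).choose_spec a).symm

theorem predualMap_sub (t : ℝ≥0) (ξ η : X) :
    predualMap hφ t (ξ - η) = predualMap hφ t ξ - predualMap hφ t η :=
  eq_of_forall_apply_eq (ι := ι) fun a => by simp [apply_predualMap]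

theorem predualMap_add_apply (s t : ℝ≥0) (ξ : X) :
    predualMap hφ (s + t) ξ = predualMap hφ s (predualMap hφ t ξ) :=
  eq_of_forall_apply_eq (ι := ι) fun a => by
    simp only [apply_predualMap]
    rw [add_comm, hφ.map_add]

theorem norm_predualMap_le (t : ℝ≥0) (ξ : X) : ‖predualMap hφ t ξ‖ ≤ ‖ξ‖ :=
  norm_le_of_forall_apply_le (ι := ι) (norm_nonneg _) fun a => by
    rw [apply_predualMap, mul_comm]
    exact (norm_apply_le _ _).trans
      (mul_le_mul_of_nonneg_right (hφ.contractive t a) (norm_nonneg _))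

theorem continuous_apply_predualMap (a : A) (ξ : X) :
    Continuous fun t => ι a (predualMap hφ t ξ) := by
  simp only [apply_predualMap]
  have h : Continuous fun t => fun ξ : X => ι (φ t a) ξ :=
    @Continuous.comp _ _ _ _ (ultraweak ι) _ (fun t => φ t a) (fun (a : A) (ξ : X) => ι a ξ)
      continuous_induced_dom (hφ.continuous a)
  exact (continuous_apply ξ).comp h

theorem dense_continuousAt_predualMap [TopologicalSpace.SeparableSpace X] (ξ : X) :
    Dense {t : ℝ≥0 | ContinuousAt (fun t => predualMap hφ t ξ) t} := by
  have hcl : ∀ (η : X) (r : ℝ), 0 ≤ r → IsClosed {t : ℝ≥0 | ‖predualMap hφ t ξ - η‖ ≤ r} := by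
    intro η r hr
    have e : {t : ℝ≥0 | ‖predualMap hφ t ξ - η‖ ≤ r} =
        ⋂ a : A, {t | ‖ι a (predualMap hφ t ξ) - ι a η‖ ≤ r * ‖a‖} := by
      ext t
      simp only [Set.mem_ofPred_eq, Set.mem_iInter, ← map_sub]
      refine ⟨fun h a => (norm_apply_le _ _).trans ?_, norm_le_of_forall_apply_le hr⟩
      rw [mul_comm]
      exact mul_le_mul_of_nonneg_right h (norm_nonneg _)
    rw [e]
    refine isClosed_iInter fun a => isClosed_le ?_ continuous_const
    exact ((continuous_apply_predualMap hφ a ξ).sub continuous_const).norm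
  let f : ℕ → ℕ → Set ℝ≥0 := fun m i =>
    {t | ‖predualMap hφ t ξ - TopologicalSpace.denseSeq X i‖ ≤ 1 / ((m : ℝ) + 1)}
  have hU : ∀ m, Dense (⋃ i, interior (f m i)) := by
    intro m
    refine dense_iUnion_interior_of_closed (fun i => hcl _ _ (by positivity)) ?_
    refine Set.eq_univ_of_forall fun t => Set.mem_iUnion.2 ?_
    obtain ⟨i, hi⟩ := (TopologicalSpace.denseRange_denseSeq X).exists_dist_lt
      (predualMap hφ t ξ) (show (0 : ℝ) < 1 / ((m : ℝ) + 1) by positivity)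
    rw [dist_eq_norm] at hi
    exact ⟨i, hi.le⟩
  refine (dense_iInter_of_isOpen (fun m => isOpen_iUnion fun i => isOpen_interior) hU).mono ?_
  intro t ht
  rw [Set.mem_ofPred_eq, Metric.continuousAt_iff']
  intro ε hε
  obtain ⟨m, hm⟩ := exists_nat_one_div_lt (half_pos hε)
  obtain ⟨i, hi⟩ := Set.mem_iUnion.1 (Set.mem_iInter.1 ht m)
  have h1 : ‖predualMap hφ t ξ - TopologicalSpace.denseSeq X i‖ ≤ 1 / ((m : ℝ) + 1) :=
    (interior_subset : interior (f m i) ⊆ f m i) hi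
  filter_upwards [isOpen_interior.mem_nhds hi] with s hs
  have h2 : ‖predualMap hφ s ξ - TopologicalSpace.denseSeq X i‖ ≤ 1 / ((m : ℝ) + 1) :=
    (interior_subset : interior (f m i) ⊆ f m i) hs
  have h3 := dist_triangle_right (predualMap hφ s ξ) (predualMap hφ t ξ)
    (TopologicalSpace.denseSeq X i)
  rw [dist_eq_norm, dist_eq_norm, dist_eq_norm] at h3
  rw [dist_eq_norm]
  linarith

theorem mem_closure_span_of_dense {s : Set ℝ≥0} (hs : Dense s) (ξ : X) :
    ξ ∈ closure (Submodule.span ℂ ((fun t => predualMap hφ t ξ) '' s) : Set X) := by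
  set D := (Submodule.span ℂ ((fun t => predualMap hφ t ξ) '' s)).topologicalClosure with hD
  rw [← Submodule.topologicalClosure_coe, ← hD]
  have : IsClosed (D : Set X) := Submodule.isClosed_topologicalClosure _
  by_contra hξ
  have hne : (Submodule.Quotient.mk ξ : X ⧸ D) ≠ 0 := by
    rwa [Ne, Submodule.Quotient.mk_eq_zero]
  obtain ⟨f, hf⟩ := SeparatingDual.exists_ne_zero (R := ℂ) hne
  set a : A := ι.symm (f.comp D.mkQL) with ha
  have haf : ∀ η, ι a η = f (Submodule.Quotient.mk η) := fun η => by
    rw [ha, ι.apply_symm_apply]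
    rfl
  have h0 : (fun t => ι a (predualMap hφ t ξ)) = fun _ => 0 := by
    refine (continuous_apply_predualMap hφ a ξ).ext_on hs continuous_const fun t ht => ?_
    have : (Submodule.Quotient.mk (predualMap hφ t ξ) : X ⧸ D) = 0 :=
      (Submodule.Quotient.mk_eq_zero _).2
        (Submodule.le_topologicalClosure _ (Submodule.subset_span ⟨t, ht, rfl⟩))
    simp only [haf, this, map_zero]
  have h1 := congrFun h0 0
  simp only [apply_predualMap, hφ.map_zero] at h1
  exact hf ((haf ξ).symm.trans h1)

theorem tendsto_predualMap_zero [TopologicalSpace.SeparableSpace X] (ξ : X) :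
    Tendsto (fun t => predualMap hφ t ξ) (𝓝 0) (𝓝 ξ) := by
  let D : Submodule ℂ X :=
    { carrier := {η | Tendsto (fun t => predualMap hφ t η) (𝓝 0) (𝓝 η)}
      zero_mem' := by
        have h : ∀ t, predualMap hφ t 0 = 0 := fun t => by
          simpa using predualMap_sub hφ t 0 0
        simp [h]
      add_mem' := fun {η ζ} h1 h2 => by
        have h : ∀ t, predualMap hφ t (η + ζ) = predualMap hφ t η + predualMap hφ t ζ := fun t =>
          eq_of_forall_apply_eq (ι := ι) fun a => by simp [apply_predualMap]
        simp only [Set.mem_ofPred_eq, h] at *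
        exact h1.add h2
      smul_mem' := fun c η h1 => by
        have h : ∀ t, predualMap hφ t (c • η) = c • predualMap hφ t η := fun t =>
          eq_of_forall_apply_eq (ι := ι) fun a => by simp [apply_predualMap]
        simp only [Set.mem_ofPred_eq, h] at *
        exact h1.const_smul c }
  have hsub : Submodule.span ℂ ((fun t => predualMap hφ t ξ) ''
      {t : ℝ≥0 | ContinuousAt (fun t => predualMap hφ t ξ) t}) ≤ D := by
    rw [Submodule.span_le]
    rintro _ ⟨t, ht, rfl⟩
    change Tendsto (fun s => predualMap hφ s (predualMap hφ t ξ)) (𝓝 0) (𝓝 (predualMap hφ t ξ))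
    simp only [← predualMap_add_apply]
    have h1 : Tendsto (fun s : ℝ≥0 => s + t) (𝓝 0) (𝓝 t) := by
      simpa using (tendsto_id (α := ℝ≥0) (x := 𝓝 0)).add_const t
    exact Tendsto.comp (g := fun t => predualMap hφ t ξ) ht h1
  have hξ := closure_mono (show (_ : Set X) ⊆ D from hsub)
    (mem_closure_span_of_dense hφ (dense_continuousAt_predualMap hφ ξ) ξ)
  rw [Metric.tendsto_nhds]
  intro ε hε
  obtain ⟨η, hη, hηξ⟩ := Metric.mem_closure_iff.1 hξ (ε / 3) (by positivity)
  have hη' : Tendsto (fun t => predualMap hφ t η) (𝓝 0) (𝓝 η) := hη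
  filter_upwards [Metric.tendsto_nhds.1 hη' (ε / 3) (by positivity)] with t ht
  have h1 : dist (predualMap hφ t ξ) (predualMap hφ t η) ≤ dist ξ η := by
    rw [dist_eq_norm, dist_eq_norm, ← predualMap_sub]
    exact norm_predualMap_le hφ t _
  have h2 := dist_triangle4 (predualMap hφ t ξ) (predualMap hφ t η) η ξ
  rw [dist_comm η ξ] at h2
  linarith

theorem norm_predualMap_sub_le (s t : ℝ≥0) (ξ : X) :
    ‖predualMap hφ s ξ - predualMap hφ t ξ‖ ≤ ‖predualMap hφ ((s - t) + (t - s)) ξ - ξ‖ := by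
  wlog h : t ≤ s generalizing s t
  · rw [norm_sub_rev, add_comm]
    exact this t s (not_le.1 h).le
  obtain ⟨r, rfl⟩ := exists_add_of_le h
  rw [predualMap_add_apply, ← predualMap_sub]
  · refine (norm_predualMap_le hφ t _).trans ?_
    simp [tsub_eq_zero_of_le h]

/-- The orbits of the predual semigroup are norm continuous. -/
theorem continuous_predualMap [TopologicalSpace.SeparableSpace X] (ξ : X) :
    Continuous fun t => predualMap hφ t ξ := by
  rw [continuous_iff_continuousAt]
  intro t
  rw [ContinuousAt, tendsto_iff_norm_sub_tendsto_zero]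
  refine squeeze_zero (fun _ => norm_nonneg _)
    (fun s => norm_predualMap_sub_le hφ s t ξ) ?_
  have h1 : Tendsto (fun s : ℝ≥0 => (s - t) + (t - s)) (𝓝 t) (𝓝 0) := by
    have : Continuous fun s : ℝ≥0 => (s - t) + (t - s) := by fun_prop
    simpa using this.tendsto t
  have h2 := ((tendsto_predualMap_zero hφ ξ).comp h1).sub_const ξ
  simpa using h2.norm

include hφ in
theorem continuous_compFunctional {ψ : A →ₚ[ℂ] ℂ}
    (hψ : Continuous[ultraweak ι, inferInstance] ψ) (t : ℝ≥0) :
    Continuous[ultraweak ι, inferInstance] (compFunctional ψ (φ t)) := by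
  obtain ⟨ξ, hξ⟩ := PositiveNormal.continuous_iff.1 hψ
  exact PositiveNormal.continuous_iff.2
    ⟨predualMap hφ t ξ, fun a => by rw [compFunctional_apply, hξ, apply_predualMap]⟩

variable {κ : Type*} {l : Filter κ}

include hφ in
theorem StrongTendsto.semigroup_zero [TopologicalSpace.SeparableSpace X] {s : κ → ℝ≥0} {t : ℝ≥0}
    (hs : Tendsto s l (𝓝 t)) {u : κ → A} (hu : StrongTendsto ι u l 0) {C : ℝ}
    (hC : ∀ k, ‖u k‖ ≤ C) : StrongTendsto ι (fun k => φ (s k) (u k)) l 0 := by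
  intro ψ hψ
  obtain ⟨ξ, hξ⟩ := PositiveNormal.continuous_iff.1 hψ
  have h1 := hu _ (continuous_compFunctional hφ hψ t)
  simp only [compFunctional_apply, sub_zero, hξ, ← apply_predualMap hφ] at h1
  have h2 : Tendsto (fun k => ι (star (u k) * u k) (predualMap hφ (s k) ξ)) l (𝓝 0) := by
    have h3 : Tendsto (fun k => ι (star (u k) * u k)
        (predualMap hφ (s k) ξ - predualMap hφ t ξ)) l (𝓝 0) := by
      have h4 : Tendsto (fun k => predualMap hφ (s k) ξ - predualMap hφ t ξ) l (𝓝 0) := by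
        simpa using (((continuous_predualMap hφ ξ).tendsto t).comp hs).sub_const
          (predualMap hφ t ξ)
      have h5 := h4.norm.const_mul (C * C)
      rw [norm_zero, mul_zero] at h5
      refine squeeze_zero_norm (fun k => (norm_apply_le _ _).trans ?_) h5
      rw [CStarRing.norm_star_mul_self]
      exact mul_le_mul_of_nonneg_right
        (mul_self_le_mul_self (norm_nonneg _) (hC k)) (norm_nonneg _)
    simpa using h3.add h1
  refine tendsto_zero_of_nonneg_of_le (fun k => map_nonneg ψ (star_mul_self_nonneg _))
    (fun k => ?_) h2
  rw [sub_zero, apply_predualMap, ← hξ]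
  exact OrderHomClass.mono ψ (star_map_mul_map_le _ (hφ.unital _) _)

include hφ in
theorem strongTendsto_semigroup_self [CompleteSpace X] {s : κ → ℝ≥0} (hs : Tendsto s l (𝓝 0))
    (y : A) : StrongTendsto ι (fun k => φ (s k) y) l y := by
  intro ψ hψ
  obtain ⟨ξ, hξ⟩ := PositiveNormal.continuous_iff.1 hψ
  have hlim : ∀ b c : A, Tendsto (fun k => ψ (b * φ (s k) c)) l (𝓝 (ψ (b * c))) := by
    intro b c
    obtain ⟨η, hη⟩ := exists_apply_mul_mul_eq (ι := ι) b 1 ξ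
    simp only [mul_one] at hη
    simp only [hξ, hη, ← apply_predualMap hφ]
    have := ((continuous_apply_predualMap hφ c η).tendsto 0).comp hs
    simpa only [apply_predualMap, hφ.map_zero, Function.comp_def] using this
  have h1 := hlim (star y) y
  have h2 := hlim 1 (star y * y)
  have h3 : Tendsto (fun k => ψ (star (φ (s k) y) * y)) l (𝓝 (ψ (star y * y))) := by
    have := h1.star
    simpa only [← map_star, star_mul, star_star] using this
  have h4 := ((h2.sub h1).sub h3).add_const (ψ (star y * y))
  simp only [one_mul, sub_self, zero_sub, neg_add_cancel] at h4
  refine tendsto_zero_of_nonneg_of_le (fun k => map_nonneg ψ (star_mul_self_nonneg _))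
    (fun k => ?_) h4
  rw [← map_sub, ← map_sub, ← map_add]
  refine OrderHomClass.mono ψ ?_
  have e : star (φ (s k) y - y) * (φ (s k) y - y) =
      star (φ (s k) y) * φ (s k) y - star y * φ (s k) y - star (φ (s k) y) * y + star y * y := by
    simp only [star_sub, sub_mul, mul_sub]
    abel
  rw [e]
  gcongr
  exact star_map_mul_map_le _ (hφ.unital _) _

/-- Joint strong continuity of a CP₀-semigroup on bounded sets. -/
theorem StrongTendsto.semigroup [CompleteSpace X] [TopologicalSpace.SeparableSpace X]
    (hφ : IsCP0Semigroup ι φ) {s : κ → ℝ≥0} {t : ℝ≥0} (hs : Tendsto s l (𝓝 t)) {u : κ → A} {a : A}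
    (hu : StrongTendsto ι u l a) {C : ℝ} (hC : ∀ k, ‖u k‖ ≤ C) :
    StrongTendsto ι (fun k => φ (s k) (u k)) l (φ t a) := by
  have h1 : StrongTendsto ι (fun k => φ (s k) (u k - a)) l 0 :=
    (strongTendsto_iff_sub.1 hu).semigroup_zero hφ hs (C := C + ‖a‖)
      fun k => (norm_sub_le _ _).trans (add_le_add_left (hC k) _)
  have hd1 : Tendsto (fun k => s k - t) l (𝓝 0) := by
    simpa using hs.sub (tendsto_const_nhds (x := t))
  have hd2 : Tendsto (fun k => t - s k) l (𝓝 0) := by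
    simpa using (tendsto_const_nhds (x := t)).sub hs
  have hm : Tendsto (fun k => min (s k) t) l (𝓝 t) := by
    simpa using hs.min (tendsto_const_nhds (x := t))
  have h2 : StrongTendsto ι (fun k => φ (s k - t) a - φ (t - s k) a) l 0 := by
    simpa using (strongTendsto_semigroup_self hφ hd1 a).sub (strongTendsto_semigroup_self hφ hd2 a)
  have h3 := h2.semigroup_zero hφ hm (C := ‖a‖ + ‖a‖) fun k =>
    (norm_sub_le _ _).trans (add_le_add (hφ.contractive _ _) (hφ.contractive _ _))
  rw [strongTendsto_iff_sub]
  have h4 := h1.add h3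
  rw [add_zero] at h4
  convert h4 using 2 with k
  rw [map_sub, map_sub, ← hφ.map_add, ← hφ.map_add, add_comm (min _ _) (s k - t), tsub_add_min,
    min_comm, add_comm (min _ _) (t - s k), tsub_add_min]
  abel

end Semigroup

end MomentPoly

namespace MomentPoly

/-! ### Naturality of the decomposition -/

section Naturality

variable {A B : Type*}

/-- Replace the letters `(t, b)` of a pair by `(f b, h b)`. -/
def relabel (f : B → ℝ≥0) (h : B → A) (l : List (ℝ≥0 × B)) : List (ℝ≥0 × A) :=
  l.map fun p => (f p.2, h p.2)

variable {f : B → ℝ≥0} {h : B → A} {l : List (ℝ≥0 × B)}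

theorem decompose_relabel (H : ∀ p ∈ l, f p.2 = 0 ↔ p.1 = 0) :
    decompose (relabel f h l) = ((decompose l).1.map h,
      (decompose l).2.map fun b => (relabel f h b.1, b.2.map h)) := by
  induction l with
  | nil => simp [relabel, decompose]
  | cons q l ih =>
    obtain ⟨t, b⟩ := q
    have ih := ih fun p hp => H p (List.mem_cons_of_mem _ hp)
    have hq : f b = 0 ↔ t = 0 := H (t, b) List.mem_cons_self
    have e : relabel f h ((t, b) :: l) = (f b, h b) :: relabel f h l := rfl
    rw [e]
    by_cases ht : t = 0
    · rw [decompose, if_pos (hq.2 ht), decompose, if_pos ht, ih, List.map_cons]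
    · rw [decompose, if_neg (mt hq.1 ht), decompose, if_neg ht, ih]
      rcases decompose l with ⟨_ | ⟨z, zs⟩, _ | ⟨⟨w, z'⟩, bs⟩⟩ <;> simp [relabel]

theorem numBlocks_relabel (H : ∀ p ∈ l, f p.2 = 0 ↔ p.1 = 0) :
    numBlocks (relabel f h l) = numBlocks l := by
  simp [numBlocks, decompose_relabel H]

theorem zeroPart_relabel (H : ∀ p ∈ l, f p.2 = 0 ↔ p.1 = 0) (i : ℕ) :
    zeroPart (relabel f h l) i = (zeroPart l i).map h := by
  rcases i with _ | i
  · simp [zeroPart, decompose_relabel H]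
  · simp only [zeroPart, decompose_relabel H, List.getD_eq_getElem?_getD, List.getElem?_map]
    rcases (decompose l).2[i]? with _ | b <;> simp

theorem nonzeroPart_relabel (H : ∀ p ∈ l, f p.2 = 0 ↔ p.1 = 0) (i : ℕ) :
    nonzeroPart (relabel f h l) i = relabel f h (nonzeroPart l i) := by
  simp only [nonzeroPart, decompose_relabel H, List.getD_eq_getElem?_getD, List.getElem?_map]
  rcases (decompose l).2[i - 1]? with _ | b <;> simp [relabel]

theorem decompose_zeros (l : List (ℝ≥0 × B)) :
    (∀ b ∈ (decompose l).1, ∃ p ∈ l, p.2 = b) ∧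
      ∀ c ∈ (decompose l).2, ∀ b ∈ c.2, ∃ p ∈ l, p.2 = b := by
  induction l with
  | nil => simp [decompose]
  | cons q l ih =>
    obtain ⟨t, a⟩ := q
    have lift : ∀ {b : B}, (∃ p ∈ l, p.2 = b) → ∃ p ∈ (t, a) :: l, p.2 = b :=
      fun ⟨p, hp, e⟩ => ⟨p, List.mem_cons_of_mem _ hp, e⟩
    by_cases ht : t = 0
    · rw [decompose, if_pos ht]
      refine ⟨fun b hb => ?_, fun c hc b hb => lift (ih.2 c hc b hb)⟩
      rcases List.mem_cons.1 hb with rfl | hb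
      · exact ⟨_, List.mem_cons_self, rfl⟩
      · exact lift (ih.1 b hb)
    · rcases decompose_cons_of_ne ht a l with ⟨w, z, bs, h1, h2⟩ | ⟨_, h2⟩
      · rw [h1] at ih
        rw [h2]
        refine ⟨by simp, fun c hc b hb => ?_⟩
        rcases List.mem_cons.1 hc with rfl | hc
        · exact lift (ih.2 (w, z) List.mem_cons_self b hb)
        · exact lift (ih.2 c (List.mem_cons_of_mem _ hc) b hb)
      · rw [h2]
        refine ⟨by simp, fun c hc b hb => ?_⟩
        rcases List.mem_cons.1 hc with rfl | hc
        · exact lift (ih.1 b hb)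
        · exact lift (ih.2 c hc b hb)

theorem mem_zeroPart {i : ℕ} {b : B} (hb : b ∈ zeroPart l i) : ∃ p ∈ l, p.2 = b := by
  rcases i with _ | i
  · exact (decompose_zeros l).1 b hb
  · rw [zeroPart, List.getD_eq_getElem?_getD] at hb
    rcases hc : (decompose l).2[i]? with _ | c
    · simp [hc] at hb
    · rw [hc] at hb
      exact (decompose_zeros l).2 c (List.mem_of_getElem? hc) b hb

theorem minTime_eq {l : List (ℝ≥0 × A)} {τ : ℝ≥0} (h0 : τ ≠ 0) (hτ : ∃ p ∈ l, p.1 = τ)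
    (hmin : ∀ p ∈ l, p.1 ≠ 0 → τ ≤ p.1) : minTime l = τ := by
  obtain ⟨q, hq, rfl⟩ := hτ
  refine IsLeast.csInf_eq ⟨mem_posTimes.2 ⟨h0, q, hq, rfl⟩, fun t ht => ?_⟩
  obtain ⟨h, p, hp, rfl⟩ := mem_posTimes.1 ht
  exact hmin p hp h

end Naturality

/-! ### Unfolding the recursion -/

section Recursion

variable {A : Type*} [Ring A] [Algebra ℂ A] {φ : ℝ≥0 → A → A} {ω : A → ℂ} {l : List (ℝ≥0 × A)}

theorem momentPolynomial_of_zero (h : ∀ p ∈ l, p.1 = 0) :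
    momentPolynomial φ ω l = (l.map Prod.snd).prod := by
  rw [momentPolynomial, dif_pos h]

theorem momentPolynomial_of_min (hφ : ∀ a, φ 0 a = a) {q : ℝ≥0 × A} (hq : q ∈ l)
    (hmin : ∀ p ∈ l, q.1 ≤ p.1) :
    momentPolynomial φ ω l = φ q.1 (momentPolynomial φ ω (shift q.1 l)) := by
  by_cases h0 : q.1 = 0
  · have e : shift 0 l = l := by simp [shift]
    rw [h0, hφ, e]
  · have h1 : ¬∀ p ∈ l, p.1 = 0 := fun h => h0 (h q hq)
    have h2 : ∀ p ∈ l, p.1 ≠ 0 := fun p hp h => h0 (le_antisymm (h ▸ hmin p hp) bot_le)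
    rw [momentPolynomial, dif_neg h1, dif_pos h2,
      minTime_eq h0 ⟨q, hq, rfl⟩ fun p hp _ => hmin p hp]

theorem momentPolynomial_of_mixed (h0 : ¬∀ p ∈ l, p.1 = 0) (h : ¬∀ p ∈ l, p.1 ≠ 0) :
    momentPolynomial φ ω l = ∑ S ∈ collapseSets (numBlocks l),
      (-1 : ℤ) ^ (numBlocks l + S.card) • momentPolynomial φ ω
        (collapse ω (fun i => momentPolynomial φ ω (nonzeroPart l i)) l S) := by
  rw [momentPolynomial, dif_neg h0, dif_neg h]
  exact Finset.sum_coe_sort (collapseSets (numBlocks l)) fun S =>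
    (-1 : ℤ) ^ (numBlocks l + S.card) • momentPolynomial φ ω
      (collapse ω (fun i => momentPolynomial φ ω (nonzeroPart l i)) l S)

end Recursion

/-! ### Convergent families of pairs -/

section Families

variable {A : Type*} [CStarAlgebra A] [PartialOrder A] [StarOrderedRing A]
variable {X : Type*} [NormedAddCommGroup X] [NormedSpace ℂ X]

/-- The sequence `x (some k)` is bounded and converges strongly to `x none`. -/
def BoundedStrongTendsto (ι : A ≃ₗᵢ[ℂ] StrongDual ℂ X) (x : Option ℕ → A) : Prop :=
  StrongTendsto ι (fun k => x (some k)) atTop (x none) ∧ ∃ C, ∀ i, ‖x i‖ ≤ C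

variable {ι : A ≃ₗᵢ[ℂ] StrongDual ℂ X} {x y : Option ℕ → A}

theorem BoundedStrongTendsto.mul [CompleteSpace X] (hx : BoundedStrongTendsto ι x)
    (hy : BoundedStrongTendsto ι y) : BoundedStrongTendsto ι fun i => x i * y i := by
  obtain ⟨hx, C, hC⟩ := hx
  obtain ⟨hy, D, hD⟩ := hy
  refine ⟨hx.mul hy fun k => hC (some k), C * D, fun i => (norm_mul_le _ _).trans ?_⟩
  exact mul_le_mul (hC i) (hD i) (norm_nonneg _) ((norm_nonneg _).trans (hC i))

theorem BoundedStrongTendsto.list_prod [CompleteSpace X] {σ : Type*} {z : σ → Option ℕ → A}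
    {l : List σ} (h : ∀ b ∈ l, BoundedStrongTendsto ι (z b)) :
    BoundedStrongTendsto ι fun i => (l.map fun b => z b i).prod := by
  induction l with
  | nil => exact ⟨StrongTendsto.const 1, ‖(1 : A)‖, fun _ => by simp⟩
  | cons b l ih =>
    simpa only [List.map_cons, List.prod_cons] using
      (h b List.mem_cons_self).mul (ih fun c hc => h c (List.mem_cons_of_mem _ hc))

theorem BoundedStrongTendsto.sum_zsmul {σ : Type*} {s : Finset σ} {n : σ → ℤ}
    {z : σ → Option ℕ → A} (h : ∀ j ∈ s, BoundedStrongTendsto ι (z j)) :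
    BoundedStrongTendsto ι fun i => ∑ j ∈ s, n j • z j i := by
  choose! C hC using fun j hj => (h j hj).2
  refine ⟨StrongTendsto.sum fun j hj => (h j hj).1.zsmul (n j), ∑ j ∈ s, ‖n j‖ * C j,
    fun i => norm_sum_le_of_le _ fun j hj => (norm_zsmul_le _ _).trans ?_⟩
  exact mul_le_mul_of_nonneg_left (hC j hj i) (norm_nonneg _)

theorem BoundedStrongTendsto.state {ω : A →ₚ[ℂ] ℂ} (hω : IsFaithfulNormalState ι ω)
    (hx : BoundedStrongTendsto ι x) :
    BoundedStrongTendsto ι fun i => algebraMap ℂ A (ω (x i)) := by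
  have h := hx.1.tendsto_state hω
  refine ⟨strongTendsto_algebraMap h, ?_⟩
  obtain ⟨C, hC⟩ := hx.2
  obtain ⟨ξ, hξ⟩ := PositiveNormal.continuous_iff.1 hω.normal
  refine ⟨C * ‖ξ‖ * ‖(1 : A)‖, fun i => ?_⟩
  simp only [Algebra.algebraMap_eq_smul_one, hξ]
  refine (norm_smul_le _ _).trans (mul_le_mul_of_nonneg_right ?_ (norm_nonneg _))
  exact (norm_apply_le _ _).trans (mul_le_mul_of_nonneg_right (hC i) (norm_nonneg _))

theorem BoundedStrongTendsto.semigroup [CompleteSpace X] [TopologicalSpace.SeparableSpace X]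
    {φ : ℝ≥0 → A →CP A} (hφ : IsCP0Semigroup ι φ) {T : Option ℕ → ℝ≥0}
    (hT : Tendsto (fun k => T (some k)) atTop (𝓝 (T none))) (hx : BoundedStrongTendsto ι x) :
    BoundedStrongTendsto ι fun i => φ (T i) (x i) := by
  obtain ⟨hx, C, hC⟩ := hx
  exact ⟨hx.semigroup hφ hT fun k => hC (some k), C,
    fun i => (hφ.contractive _ _).trans (hC i)⟩

/-- Lists of letters depending on an index in `Option ℕ`; the first component of an entry only
records whether its times vanish. -/
abbrev Family (A : Type*) := List (ℝ≥0 × ((Option ℕ → ℝ≥0) × (Option ℕ → A)))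

/-- The pair with index `i` in a family. -/
def Family.eval (L : Family A) (i : Option ℕ) : List (ℝ≥0 × A) :=
  relabel (fun b => b.1 i) (fun b => b.2 i) L

/-- The family converges non-crossingly to its entry with index `none`. -/
structure Family.Converges (ι : A ≃ₗᵢ[ℂ] StrongDual ℂ X) (L : Family A) : Prop where
  le_iff : ∀ p ∈ L, ∀ q ∈ L, ∀ i j, p.2.1 i ≤ q.2.1 i ↔ p.2.1 j ≤ q.2.1 j
  time : ∀ p ∈ L, Tendsto (fun k => p.2.1 (some k)) atTop (𝓝 (p.2.1 none))
  letter : ∀ p ∈ L, BoundedStrongTendsto ι p.2.2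

/-- The times of every letter all vanish or are all nonzero. -/
def Family.Coherent (L : Family A) : Prop :=
  ∀ i, ∀ p ∈ L, p.2.1 i = 0 ↔ p.1 = 0

variable {L : Family A}

theorem Family.mem_eval {i : Option ℕ} {p : ℝ≥0 × A} :
    p ∈ L.eval i ↔ ∃ q ∈ L, (q.2.1 i, q.2.2 i) = p := List.mem_map

theorem Family.Converges.sublist {L' : Family A} (hL : L.Converges ι) (h : ∀ p ∈ L', p ∈ L) :
    L'.Converges ι :=
  ⟨fun p hp q hq => hL.le_iff p (h p hp) q (h q hq), fun p hp => hL.time p (h p hp),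
    fun p hp => hL.letter p (h p hp)⟩

/-- Subtract the times `T` from all times of a family. -/
noncomputable def Family.shift (T : Option ℕ → ℝ≥0) (L : Family A) : Family A :=
  L.map fun p => (p.2.1 none - T none, fun i => p.2.1 i - T i, p.2.2)

theorem Family.eval_shift (T : Option ℕ → ℝ≥0) (i : Option ℕ) :
    (L.shift T).eval i = MomentPoly.shift (T i) (L.eval i) := by
  simp [Family.shift, Family.eval, MomentPoly.shift, relabel]

/-- `q` has the least time among the entries of `L` satisfying `P`, for every index. -/
theorem Family.Converges.exists_min (hL : L.Converges ι) {P : ℝ≥0 → Prop}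
    (hP : ∃ p ∈ L, P p.1) :
    ∃ q ∈ L, P q.1 ∧ ∀ p ∈ L, P p.1 → ∀ i, q.2.1 i ≤ p.2.1 i := by
  classical
  obtain ⟨p, hp, hPp⟩ := hP
  obtain ⟨q, hq, hmin⟩ := Set.exists_min_image {p | p ∈ L ∧ P p.1} (fun p => p.2.1 none)
    (L.finite_toSet.subset fun p hp => hp.1) ⟨p, hp, hPp⟩
  exact ⟨q, hq.1, hq.2, fun p hp h i =>
    (hL.le_iff q hq.1 p hp i none).2 (hmin p ⟨hp, h⟩)⟩

theorem Family.Converges.shift (hL : L.Converges ι)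
    {q : ℝ≥0 × ((Option ℕ → ℝ≥0) × (Option ℕ → A))} (hq : q ∈ L)
    (hmin : ∀ p ∈ L, ∀ i, q.2.1 i ≤ p.2.1 i) :
    (L.shift q.2.1).Converges ι ∧ (L.shift q.2.1).Coherent := by
  refine ⟨⟨?_, ?_, ?_⟩, ?_⟩
  · intro p' hp' r' hr' i j
    obtain ⟨p, hp, rfl⟩ := List.mem_map.1 hp'
    obtain ⟨r, hr, rfl⟩ := List.mem_map.1 hr'
    simp only [tsub_le_tsub_iff_right (hmin r hr _)]
    exact hL.le_iff p hp r hr i j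
  · intro p' hp'
    obtain ⟨p, hp, rfl⟩ := List.mem_map.1 hp'
    exact (hL.time p hp).sub (hL.time q hq)
  · intro p' hp'
    obtain ⟨p, hp, rfl⟩ := List.mem_map.1 hp'
    exact hL.letter p hp
  · intro i p' hp'
    obtain ⟨p, hp, rfl⟩ := List.mem_map.1 hp'
    simp only [tsub_eq_zero_iff_le]
    exact hL.le_iff p hp q hq i none

theorem Family.Coherent.numBlocks_eval (hL : L.Coherent) (i : Option ℕ) :
    numBlocks (L.eval i) = numBlocks L :=
  numBlocks_relabel (f := fun b : (Option ℕ → ℝ≥0) × (Option ℕ → A) => b.1 i) (h := fun b => b.2 i) (hL i)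

theorem Family.Coherent.zeroPart_eval (hL : L.Coherent) (i : Option ℕ) (j : ℕ) :
    zeroPart (L.eval i) j = (zeroPart L j).map fun b => b.2 i :=
  zeroPart_relabel (f := fun b : (Option ℕ → ℝ≥0) × (Option ℕ → A) => b.1 i) (h := fun b => b.2 i) (hL i) j

theorem Family.Coherent.nonzeroPart_eval (hL : L.Coherent) (i : Option ℕ) (j : ℕ) :
    nonzeroPart (L.eval i) j = Family.eval (nonzeroPart L j) i :=
  nonzeroPart_relabel (f := fun b : (Option ℕ → ℝ≥0) × (Option ℕ → A) => b.1 i) (h := fun b => b.2 i) (hL i) j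

/-- The collapse of a family, where `T` are the least nonzero times. -/
noncomputable def Family.collapse (ω : A → ℂ) (T : Option ℕ → ℝ≥0) (x : ℕ → Option ℕ → A)
    (L : Family A) (S : Finset ℕ) : Family A :=
  (List.range (2 * numBlocks L + 1)).flatMap fun j =>
    if j ∈ S ∪ {0, 2 * numBlocks L} then
      if Odd j then [(0, fun _ => 0, x ((j + 1) / 2))]
      else [(0, fun _ => 0, fun i => ((zeroPart L (j / 2)).map fun b => b.2 i).prod)]
    else
      if Odd j then nonzeroPart L ((j + 1) / 2)
      else [(1, T, fun i => algebraMap ℂ A (ω ((zeroPart L (j / 2)).map fun b => b.2 i).prod))]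

theorem Family.eval_collapse (ω : A → ℂ) {T : Option ℕ → ℝ≥0} (x : ℕ → Option ℕ → A)
    (hL : L.Coherent) (hT : ∀ i, minTime (L.eval i) = T i) (S : Finset ℕ) (i : Option ℕ) :
    (L.collapse ω T x S).eval i = MomentPoly.collapse ω (fun j => x j i) (L.eval i) S := by
  simp only [MomentPoly.collapse, hT, hL.numBlocks_eval, hL.zeroPart_eval, hL.nonzeroPart_eval]
  rw [Family.collapse, Family.eval, relabel, List.map_flatMap]
  congr 1
  funext j
  split_ifs <;> rfl

theorem Family.mem_collapse {ω : A → ℂ} {T : Option ℕ → ℝ≥0} {x : ℕ → Option ℕ → A}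
    {S : Finset ℕ} {p : ℝ≥0 × ((Option ℕ → ℝ≥0) × (Option ℕ → A))}
    (hp : p ∈ L.collapse ω T x S) :
    (p.1 = 0 ∧ p.2.1 = (fun _ => 0) ∧ ((∃ j, p.2.2 = x j) ∨
      ∃ j, p.2.2 = fun i => ((zeroPart L j).map fun b => b.2 i).prod)) ∨
    (p ∈ L ∧ p.1 ≠ 0) ∨
    (p.1 = 1 ∧ p.2.1 = T ∧
      ∃ j, p.2.2 = fun i => algebraMap ℂ A (ω ((zeroPart L j).map fun b => b.2 i).prod)) := by
  obtain ⟨j, -, hj⟩ := List.mem_flatMap.1 hp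
  split_ifs at hj
  · rw [List.mem_singleton.1 hj]
    exact Or.inl ⟨rfl, rfl, Or.inl ⟨_, rfl⟩⟩
  · rw [List.mem_singleton.1 hj]
    exact Or.inl ⟨rfl, rfl, Or.inr ⟨_, rfl⟩⟩
  · exact Or.inr (Or.inl (mem_nonzeroPart hj))
  · rw [List.mem_singleton.1 hj]
    exact Or.inr (Or.inr ⟨rfl, rfl, _, rfl⟩)

theorem Family.Converges.collapse [CompleteSpace X] {ω : A →ₚ[ℂ] ℂ}
    (hω : IsFaithfulNormalState ι ω) (hL : L.Converges ι) (hL0 : L.Coherent)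
    {q : ℝ≥0 × ((Option ℕ → ℝ≥0) × (Option ℕ → A))} (hq : q ∈ L) (hq0 : q.1 ≠ 0)
    {x : ℕ → Option ℕ → A} (hx : ∀ j, BoundedStrongTendsto ι (x j)) (S : Finset ℕ) :
    (L.collapse ω q.2.1 x S).Converges ι ∧ (L.collapse ω q.2.1 x S).Coherent := by
  have hprod : ∀ j, BoundedStrongTendsto ι fun i =>
      ((zeroPart L j).map fun b => b.2 i).prod := fun j =>
    BoundedStrongTendsto.list_prod (l := zeroPart L j)
      (z := fun b : (Option ℕ → ℝ≥0) × (Option ℕ → A) => b.2) fun b hb => by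
      obtain ⟨p, hp, rfl⟩ := mem_zeroPart hb
      exact hL.letter p hp
  have htime : ∀ p ∈ L.collapse ω q.2.1 x S, (p.1 = 0 ∧ p.2.1 = fun _ => 0) ∨
      (p.1 ≠ 0 ∧ ∃ r ∈ L, r.1 ≠ 0 ∧ r.2.1 = p.2.1) := by
    intro p hp
    rcases Family.mem_collapse hp with h | h | h
    · exact Or.inl ⟨h.1, h.2.1⟩
    · exact Or.inr ⟨h.2, p, h.1, h.2, rfl⟩
    · exact Or.inr ⟨by simp [h.1], q, hq, hq0, h.2.1.symm⟩
  refine ⟨⟨?_, ?_, ?_⟩, ?_⟩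
  · intro p hp r hr i j
    rcases htime p hp with h | ⟨-, p', hp', h0, h⟩
    · simp [h.2]
    · rcases htime r hr with h' | ⟨-, r', hr', -, h'⟩
      · rw [← h, h'.2]
        simp only [le_zero_iff, hL0 _ p' hp']
      · rw [← h, ← h']
        exact hL.le_iff p' hp' r' hr' i j
  · intro p hp
    rcases htime p hp with h | ⟨-, p', hp', h0, h⟩
    · simp [h.2]
    · rw [← h]
      exact hL.time p' hp'
  · intro p hp
    rcases Family.mem_collapse hp with ⟨-, -, ⟨j, h⟩ | ⟨j, h⟩⟩ | h | ⟨-, -, j, h⟩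
    · exact h ▸ hx j
    · exact h ▸ hprod j
    · exact hL.letter p h.1
    · exact h ▸ (hprod j).state hω
  · intro i p hp
    rcases htime p hp with h | ⟨h1, p', hp', h0, h⟩
    · simp [h.1, h.2]
    · rw [← h]
      exact iff_of_false (mt (hL0 i p' hp').1 h0) h1

variable [CompleteSpace X] [TopologicalSpace.SeparableSpace X]
variable {φ : ℝ≥0 → A →CP A} (hφ : IsCP0Semigroup ι φ)
variable {ω : A →ₚ[ℂ] ℂ} (hω : IsFaithfulNormalState ι ω)

include hφ in
theorem Family.Converges.momentPolynomial_of_shift (hL : L.Converges ι)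
    {q : ℝ≥0 × ((Option ℕ → ℝ≥0) × (Option ℕ → A))} (hq : q ∈ L)
    (hmin : ∀ p ∈ L, ∀ i, q.2.1 i ≤ p.2.1 i)
    (h : BoundedStrongTendsto ι fun i =>
      momentPolynomial (fun s => φ s) ω ((L.shift q.2.1).eval i)) :
    BoundedStrongTendsto ι fun i => momentPolynomial (fun s => φ s) ω (L.eval i) := by
  have e : ∀ i, momentPolynomial (fun s => φ s) ω (L.eval i) =
      φ (q.2.1 i) (momentPolynomial (fun s => φ s) ω ((L.shift q.2.1).eval i)) := fun i => by
    rw [Family.eval_shift]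
    refine momentPolynomial_of_min (φ := fun s => φ s) hφ.map_zero (q := (q.2.1 i, q.2.2 i))
      (Family.mem_eval.2 ⟨q, hq, rfl⟩) fun p hp => ?_
    obtain ⟨r, hr, rfl⟩ := Family.mem_eval.1 hp
    exact hmin r hr i
  simp only [e]
  exact h.semigroup hφ (hL.time q hq)

include hφ hω in
theorem Family.Converges.momentPolynomial_of_coherent (hL : L.Converges ι) (hL0 : L.Coherent) :
    BoundedStrongTendsto ι fun i => momentPolynomial (fun s => φ s) ω (L.eval i) := by
  have wf : WellFounded (Prod.Lex (· < ·) (· < ·) : ℕ × ℕ → ℕ × ℕ → Prop) :=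
    WellFounded.prod_lex wellFounded_lt wellFounded_lt
  induction L using (InvImage.wf (fun L : Family A =>
    ((posTimes (L.eval none)).card, rank (L.eval none))) wf).induction with
  | _ L ih =>
  have hall : ∀ i, (∀ p ∈ L.eval i, p.1 = 0) ↔ ∀ p ∈ L, p.1 = 0 := fun i => by
    simp only [Family.mem_eval, forall_exists_index, and_imp, forall_apply_eq_imp_iff₂]
    exact forall₂_congr fun p hp => hL0 i p hp
  have hnone : ∀ i, (∀ p ∈ L.eval i, p.1 ≠ 0) ↔ ∀ p ∈ L, p.1 ≠ 0 := fun i => by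
    simp only [Family.mem_eval, forall_exists_index, and_imp, forall_apply_eq_imp_iff₂]
    exact forall₂_congr fun p hp => (hL0 i p hp).not
  by_cases h0 : ∀ p ∈ L, p.1 = 0
  · have e : ∀ i, momentPolynomial (fun s => φ s) ω (L.eval i) =
        (L.map fun p => p.2.2 i).prod := fun i => by
      rw [momentPolynomial_of_zero ((hall i).2 h0), Family.eval, relabel, List.map_map]
      rfl
    simp only [e]
    exact BoundedStrongTendsto.list_prod (l := L)
      (z := fun p : ℝ≥0 × ((Option ℕ → ℝ≥0) × (Option ℕ → A)) => p.2.2) hL.letter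
  have hex : ∃ p ∈ L, p.1 ≠ 0 := by
    push Not at h0
    exact h0
  obtain ⟨q, hq, hq0, hmin⟩ := hL.exists_min (P := (· ≠ 0)) hex
  have hτ : ∀ i, minTime (L.eval i) = q.2.1 i := fun i => by
    refine minTime_eq (mt (hL0 i q hq).1 hq0) ⟨_, Family.mem_eval.2 ⟨q, hq, rfl⟩, rfl⟩ ?_
    intro p hp hp0
    obtain ⟨r, hr, rfl⟩ := Family.mem_eval.1 hp
    exact hmin r hr (mt (hL0 i r hr).2 hp0) i
  have h0' : ¬∀ p ∈ L.eval none, p.1 = 0 := mt (hall none).1 h0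
  by_cases h1 : ∀ p ∈ L, p.1 ≠ 0
  · have hmin' : ∀ p ∈ L, ∀ i, q.2.1 i ≤ p.2.1 i := fun p hp => hmin p hp (h1 p hp)
    obtain ⟨hs, hs0⟩ := hL.shift hq hmin'
    refine hL.momentPolynomial_of_shift hφ hq hmin' (ih _ ?_ hs hs0)
    rw [InvImage, Family.eval_shift, ← hτ none]
    refine Prod.Lex.left _ _ (card_posTimes_shift_lt ?_)
    push Not at h0'
    exact h0'
  · have h1' : ¬∀ p ∈ L.eval none, p.1 ≠ 0 := mt (hnone none).1 h1
    set x : ℕ → Option ℕ → A := fun j i =>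
      momentPolynomial (fun s => φ s) ω (Family.eval (nonzeroPart L j) i) with hx
    have hxc : ∀ j, BoundedStrongTendsto ι (x j) := fun j => by
      refine ih (nonzeroPart L j) ?_ (hL.sublist fun p hp => (mem_nonzeroPart hp).1)
        fun i p hp => hL0 i p (mem_nonzeroPart hp).1
      have := lex_nonzeroPart h1' j
      rwa [hL0.nonzeroPart_eval] at this
    have e : ∀ i, momentPolynomial (fun s => φ s) ω (L.eval i) =
        ∑ S ∈ collapseSets (numBlocks L), (-1 : ℤ) ^ (numBlocks L + S.card) •
          momentPolynomial (fun s => φ s) ω ((L.collapse ω q.2.1 x S).eval i) := fun i => by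
      rw [momentPolynomial_of_mixed (mt (hall i).1 h0) (mt (hnone i).1 h1)]
      have hn : numBlocks (L.eval i) = numBlocks L := hL0.numBlocks_eval i
      rw [hn]
      refine Finset.sum_congr rfl fun S _ => ?_
      rw [Family.eval_collapse _ _ hL0 hτ]
      simp only [hx, hL0.nonzeroPart_eval]
    simp only [e]
    refine BoundedStrongTendsto.sum_zsmul fun S hS => ?_
    obtain ⟨hc, hc0⟩ := hL.collapse hω hL0 hq hq0 hxc S
    refine ih _ ?_ hc hc0
    rw [InvImage, Family.eval_collapse _ _ hL0 hτ]
    refine lex_collapse _ _ h0' h1' ?_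
    rwa [hL0.numBlocks_eval]

include hφ hω in
/-- The moment polynomials of a family which converges non-crossingly converge strongly. -/
theorem Family.Converges.momentPolynomial (hL : L.Converges ι) (hne : L ≠ []) :
    BoundedStrongTendsto ι fun i => momentPolynomial (fun s => φ s) ω (L.eval i) := by
  obtain ⟨p, hp⟩ := List.exists_mem_of_ne_nil L hne
  obtain ⟨q, hq, -, hmin⟩ := hL.exists_min (P := fun _ => True) ⟨p, hp, trivial⟩
  have hmin' : ∀ p ∈ L, ∀ i, q.2.1 i ≤ p.2.1 i := fun p hp => hmin p hp trivial
  obtain ⟨hs, hs0⟩ := hL.shift hq hmin'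
  exact hL.momentPolynomial_of_shift hφ hq hmin' (hs.momentPolynomial_of_coherent hφ hω hs0)

end Families

end MomentPoly

theorem mainTheorem8 {A : Type*} [CStarAlgebra A] [PartialOrder A] [StarOrderedRing A]
    {X : Type*} [NormedAddCommGroup X] [NormedSpace ℂ X] [CompleteSpace X]
    [TopologicalSpace.SeparableSpace X]
    (ι : A ≃ₗᵢ[ℂ] StrongDual ℂ X)
    (φ : ℝ≥0 → A →CP A) (hφ : MomentPoly.IsCP0Semigroup ι φ)
    (ω : A →ₚ[ℂ] ℂ) (hω : MomentPoly.IsFaithfulNormalState ι ω)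
    (n : ℕ) (hn : 1 ≤ n)
    (t : ℕ → Fin n → ℝ≥0) (t' : Fin n → ℝ≥0) (ht : MomentPoly.ConvergesNonCrossingly t t')
    (a : ℕ → Fin n → A) (a' : Fin n → A) (ha1 : ∀ k i, ‖a k i‖ ≤ 1)
    (ha : ∀ i, MomentPoly.StrongTendsto ι (fun k => a k i) atTop (a' i)) :
    MomentPoly.StrongTendsto ι
      (fun k => MomentPoly.momentPolynomial (fun s => φ s) ω (List.ofFn fun i => (t k i, a k i)))
      atTop
      (MomentPoly.momentPolynomial (fun s => φ s) ω (List.ofFn fun i => (t' i, a' i))) := by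
  let T : Fin n → Option ℕ → ℝ≥0 := fun j i => i.elim (t' j) fun k => t k j
  let x : Fin n → Option ℕ → A := fun j i => i.elim (a' j) fun k => a k j
  let L : MomentPoly.Family A := List.ofFn fun j => (0, T j, x j)
  have hle : ∀ j j' i, T j i ≤ T j' i ↔ t' j ≤ t' j' := by
    rintro j j' (_ | k)
    · exact Iff.rfl
    · exact ht.2 k j j'
  have hL : L.Converges ι := by
    refine ⟨?_, ?_, ?_⟩
    · intro p hp q hq i i'
      obtain ⟨j, rfl⟩ := (List.mem_ofFn' _ _).1 hp
      obtain ⟨j', rfl⟩ := (List.mem_ofFn' _ _).1 hq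
      exact (hle j j' i).trans (hle j j' i').symm
    · intro p hp
      obtain ⟨j, rfl⟩ := (List.mem_ofFn' _ _).1 hp
      exact tendsto_pi_nhds.1 ht.1 j
    · intro p hp
      obtain ⟨j, rfl⟩ := (List.mem_ofFn' _ _).1 hp
      refine ⟨ha j, max 1 ‖a' j‖, ?_⟩
      rintro (_ | k)
      · exact le_max_right _ _
      · exact (ha1 k j).trans (le_max_left _ _)
  have hne : L ≠ [] := by
    rw [Ne, List.ofFn_eq_nil_iff]
    omega
  have e : ∀ i, L.eval i = List.ofFn fun j => (T j i, x j i) := fun i => by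
    simp only [L, MomentPoly.Family.eval, MomentPoly.relabel, List.map_ofFn]
    rfl
  have h := (hL.momentPolynomial hφ hω hne).1
  simp only [e] at h
  exact h
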